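/- Conventions. A $C^k$ spacetime is a connected, Hausdorff, second countable four-dimensional $C^{k+1}$ manifold with a $C^k$ Lorentzian metric of signature $(-,+,+,+)$ and a time orientation induced by a continuous timelike vector field. Future-directed timelike (causal) curves $\gamma\colon[a,b]\to M$, $a<b$, are piecewise $C^1$ curves whose velocities, including the one-sided ones at break points and endpoints, are future-directed timelike (future-directed causal and nonzero); $I^+(q,\widetilde M)$ is the set of endpoints of future-directed timelike curves in $\widetilde M$ starting at $q$. Let $(M,g)$ be a smooth spacetime and let $(\widetilde M,\widetilde g)$ be a $C^0$ conformal extension of it with conformal factor $\Omega$. That is, $(\widetilde M,\widetilde g)$ is a $C^0$ spacetime in which $M$ is embedded (by a $C^1$ embedding) as a proper open subset, $\Omega\colon\overline M\to[0,\infty)$ is a continuous function on the closure of $M$ in $\widetilde M$, $\Omega|_M$ is smooth and positive, $\widetilde g=\Omega^2 g$ on $M$, and $\partial_0M:=\{q\in\partial M\mid\Omega(q)=0\}$ is non-empty. Let $\mathcal O$ be a point of the past conformal boundary $\partial_0^-M$, i.e. $\mathcal O\in\partial_0M$ and there is a future-directed timelike curve $\gamma\colon[a,b]\to\widetilde M$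 with $\gamma(a)=\mathcal O$ and $\gamma((a,b])\subset M$. Suppose $M=I^+_{\widetilde g}(\mathcal O,\widetilde M)$, and assume: (a) $(M,g)$ solves the Einstein equations with a perfect fluid $(u,\rho,p)$: $u$ is a smooth vector field on $M$ with $g(u,u)=-1$, and with $u_*=g(u,\cdot)$, $$\mathrm{Ric}_g-\tfrac12R_g\,g=8\pi\big((\rho+p)\,u_*\otimes u_*+p\,g\big).$$ (b) Every maximal integral curve of $u$ has past endpoint $\mathcal O$ in $\widetilde M$. Moreover, along each maximal integral curve of $\frac1\Omega u$, the velocity $\frac1\Omega u$ converges in $T\widetilde M$, towards the past end of the curve, to a $\widetilde g$-timelike vector at $\mathcal O$. (c) $\rho$ and $p$ extend to continuous functions $\widetilde\rho,\widetilde p$ on $M\cup\{\mathcal O\}$ (with the subspace topology of $\widetilde M$). Moreover, $\Omega^2\mathrm{Ric}_g$ extends continuously to $M\cup\{\mathcal O\}$: in some coordinates of $\widetilde M$ on a neighborhood $U$ of $\mathcal O$, each of its components extends continuously to $(U\cap M)\cup\{\mathcal O\}$; the values at $\mathcal O$ are the components of its continuous extension at $\mathcal O$, a bilinear form on $T_{\mathcal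 O}\widetilde M$. (d) $(\widetilde M,\widetilde g)$ is strongly causal at $\mathcal O$: for every neighborhood $U$ of $\mathcal O$ there is a neighborhood $V\subset U$ of $\mathcal O$ such that every future-directed causal curve in $\widetilde M$ with both endpoints in $V$ is contained in $U$. Then the continuous extension of $\Omega^2\mathrm{Ric}_g$ at $\mathcal O$ equals $8\pi\,\widetilde\rho(\mathcal O)\,\widetilde g|_{\mathcal O}$. -/

import Mathlib

open Set Filter Topology Bundle
open scoped Manifold ContDiff

/-- The model space of all four-dimensional manifolds below. -/
abbrev E4 : Type := EuclideanSpace ℝ (Fin 4)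

section Charts

variable {M : Type*} [TopologicalSpace M] [ChartedSpace E4 M]

/-- The coordinate vector `∂_μ` of the chart `e` at the point `q` of its domain. -/
noncomputable def coordVec (e : OpenPartialHomeomorph M E4) (q : M) (μ : Fin 4) :
    TangentSpace 𝓘(ℝ, E4) q :=
  mfderiv 𝓘(ℝ, E4) 𝓘(ℝ, E4) e.symm (e q) (EuclideanSpace.single μ (1 : ℝ))

/-- The coordinate expression `v^μ` of a tangent vector `v` at `q` in the chart `e`, that is,
`dx^μ(v)`. -/
noncomputable def vecCoord (e : OpenPartialHomeomorph M E4) {q : M}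
    (v : TangentSpace 𝓘(ℝ, E4) q) (μ : Fin 4) : ℝ :=
  (show E4 from mfderiv 𝓘(ℝ, E4) 𝓘(ℝ, E4) e q v) μ

end Charts

section Spacetimes

/-- A `C^n` Lorentzian metric, of signature `(-,+,+,+)`, on a four-dimensional manifold. -/
structure LorentzMetric (n : WithTop ℕ∞) (M : Type*) [TopologicalSpace M] [ChartedSpace E4 M]
    [IsManifold 𝓘(ℝ, E4) 1 M] where
  val : ∀ p : M, TangentSpace 𝓘(ℝ, E4) p →L[ℝ] TangentSpace 𝓘(ℝ, E4) p →L[ℝ] ℝ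
  symm : ∀ (p : M) (v w : TangentSpace 𝓘(ℝ, E4) p), val p v w = val p w v
  lorentzian : ∀ p : M, ∃ b : Module.Basis (Fin 4) ℝ (TangentSpace 𝓘(ℝ, E4) p),
    ∀ i j, val p (b i) (b j) = if i = j then (if i = 0 then -1 else 1) else 0
  contMDiff : ContMDiff 𝓘(ℝ, E4) (𝓘(ℝ, E4).prod 𝓘(ℝ, E4 →L[ℝ] E4 →L[ℝ] ℝ)) n
    (fun p ↦ TotalSpace.mk' (E4 →L[ℝ] E4 →L[ℝ] ℝ)
      (E := fun p : M ↦ TangentSpace 𝓘(ℝ, E4) p →L[ℝ] TangentSpace 𝓘(ℝ, E4) p →L[ℝ] ℝ)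
      p (val p))

/-- The data of a `C^n` spacetime on a manifold `M`: a `C^n` Lorentzian metric and a time
orientation, induced by a continuous timelike vector field. -/
structure Spacetime (n : WithTop ℕ∞) (M : Type*) [TopologicalSpace M] [ChartedSpace E4 M]
    [IsManifold 𝓘(ℝ, E4) 1 M] extends LorentzMetric n M where
  timeField : ∀ p : M, TangentSpace 𝓘(ℝ, E4) p
  timeField_continuous :
    Continuous (fun p ↦ (⟨p, timeField p⟩ : TangentBundle 𝓘(ℝ, E4) M))
  timeField_timelike : ∀ p : M, val p (timeField p) (timeField p) < 0

variable {n : WithTop ℕ∞} {M : Type*} [TopologicalSpace M] [ChartedSpace E4 M]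
  [IsManifold 𝓘(ℝ, E4) 1 M]

/-- Timelike tangent vectors. -/
def LorentzMetric.IsTimelike (g : LorentzMetric n M) {p : M}
    (v : TangentSpace 𝓘(ℝ, E4) p) : Prop :=
  g.val p v v < 0

/-- Future-directed timelike tangent vectors. -/
def Spacetime.IsFutureTimelike (S : Spacetime n M) (p : M)
    (v : TangentSpace 𝓘(ℝ, E4) p) : Prop :=
  S.val p v v < 0 ∧ S.val p v (S.timeField p) < 0

/-- Future-directed causal (that is, timelike or null, and nonzero) tangent vectors. -/
def Spacetime.IsFutureCausal (S : Spacetime n M) (p : M)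
    (v : TangentSpace 𝓘(ℝ, E4) p) : Prop :=
  v ≠ 0 ∧ S.val p v v ≤ 0 ∧ S.val p v (S.timeField p) < 0

/-- `γ : [a, b] → M` is a piecewise `C¹` curve (`a < b`) all of whose velocities, including both
one-sided velocities at the break points and those at the endpoints, satisfy `P`. -/
def IsPiecewiseC1With (P : ∀ p : M, TangentSpace 𝓘(ℝ, E4) p → Prop) (γ : ℝ → M) (a b : ℝ) :
    Prop :=
  a < b ∧ ∃ (N : ℕ) (t : ℕ → ℝ), t 0 = a ∧ t N = b ∧ ∀ i < N,
    t i < t (i + 1) ∧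
    ContMDiffOn 𝓘(ℝ, ℝ) 𝓘(ℝ, E4) 1 γ (Icc (t i) (t (i + 1))) ∧
    ∀ s ∈ Icc (t i) (t (i + 1)),
      P (γ s) (mfderivWithin 𝓘(ℝ, ℝ) 𝓘(ℝ, E4) γ (Icc (t i) (t (i + 1))) s (1 : ℝ))

/-- Future-directed timelike curves `γ : [a, b] → M`. -/
def Spacetime.IsFutureTimelikeCurve (S : Spacetime n M) (γ : ℝ → M) (a b : ℝ) : Prop :=
  IsPiecewiseC1With S.IsFutureTimelike γ a b

/-- Future-directed causal curves `γ : [a, b] → M`. -/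
def Spacetime.IsFutureCausalCurve (S : Spacetime n M) (γ : ℝ → M) (a b : ℝ) : Prop :=
  IsPiecewiseC1With S.IsFutureCausal γ a b

/-- The timelike future `I⁺(p, U)`. -/
def Spacetime.timelikeFuture (S : Spacetime n M) (p : M) (U : Set M) : Set M :=
  {q | q ∈ U ∧ ∃ (a b : ℝ) (γ : ℝ → M), S.IsFutureTimelikeCurve γ a b ∧
    MapsTo γ (Icc a b) U ∧ γ a = p ∧ γ b = q}

/-- Strong causality at the point `p`. -/
def Spacetime.IsStronglyCausalAt (S : Spacetime n M) (p : M) : Prop :=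
  ∀ U ∈ 𝓝 p, ∃ V ∈ 𝓝 p, V ⊆ U ∧ ∀ (a b : ℝ) (γ : ℝ → M),
    S.IsFutureCausalCurve γ a b → γ a ∈ V → γ b ∈ V → MapsTo γ (Icc a b) U

/-- `γ` is a maximal integral curve of the vector field `X`, with the open interval `J` as its
domain: it does not extend to an integral curve on a larger open interval. The values of `γ`
outside `J` are irrelevant. -/
def IsMaximalIntegralCurve (X : ∀ p : M, TangentSpace 𝓘(ℝ, E4) p) (γ : ℝ → M) (J : Set ℝ) :
    Prop :=
  IsOpen J ∧ J.OrdConnected ∧ J.Nonempty ∧ IsMIntegralCurveOn γ X J ∧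
    ∀ (γ' : ℝ → M) (J' : Set ℝ), IsOpen J' → J'.OrdConnected → IsMIntegralCurveOn γ' X J' →
      J ⊆ J' → EqOn γ γ' J → J' = J

end Spacetimes

section Curvature

variable {n : WithTop ℕ∞} {M : Type*} [TopologicalSpace M] [ChartedSpace E4 M]
  [IsManifold 𝓘(ℝ, E4) 1 M]

/-- The metric components `g_{ij}` in the chart `e`, as functions of the coordinates. -/
noncomputable def metricCoeff (g : LorentzMetric n M) (e : OpenPartialHomeomorph M E4) (y : E4) :
    Matrix (Fin 4) (Fin 4) ℝ :=
  Matrix.of fun i j ↦ g.val (e.symm y) (coordVec e (e.symm y) i) (coordVec e (e.symm y) j)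

/-- The partial derivative `∂_i f`. -/
noncomputable def pderivE4 (i : Fin 4) (f : E4 → ℝ) (y : E4) : ℝ :=
  fderiv ℝ f y (EuclideanSpace.single i (1 : ℝ))

/-- The Christoffel symbols `Γ^k_{ij} = ½ g^{kl} (∂_i g_{jl} + ∂_j g_{il} - ∂_l g_{ij})`. -/
noncomputable def christoffel (g : LorentzMetric n M) (e : OpenPartialHomeomorph M E4)
    (k i j : Fin 4) (y : E4) : ℝ :=
  (1 / 2) * ∑ l, (metricCoeff g e y)⁻¹ k l *
    (pderivE4 i (fun z ↦ metricCoeff g e z j l) y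
      + pderivE4 j (fun z ↦ metricCoeff g e z i l) y
      - pderivE4 l (fun z ↦ metricCoeff g e z i j) y)

/-- The components of the Ricci tensor in the chart `e`:
`R_{jk} = ∂_i Γ^i_{jk} - ∂_j Γ^i_{ik} + Γ^i_{im} Γ^m_{jk} - Γ^i_{jm} Γ^m_{ik}`. -/
noncomputable def ricciCoeff (g : LorentzMetric n M) (e : OpenPartialHomeomorph M E4)
    (j k : Fin 4) (y : E4) : ℝ :=
  ∑ i, (pderivE4 i (christoffel g e i j k) y - pderivE4 j (christoffel g e i i k) y
    + ∑ m, (christoffel g e i i m y * christoffel g e m j k y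
      - christoffel g e i j m y * christoffel g e m i k y))

/-- The Ricci tensor `Ric_g` at `p`, evaluated on two tangent vectors; it is computed in the
preferred chart at `p`. -/
noncomputable def ricci (g : LorentzMetric n M) (p : M) (v w : TangentSpace 𝓘(ℝ, E4) p) : ℝ :=
  ∑ j, ∑ k, ricciCoeff g (chartAt E4 p) j k (chartAt E4 p p) *
    vecCoord (chartAt E4 p) v j * vecCoord (chartAt E4 p) w k

/-- The scalar curvature `R = g^{jk} R_{jk}`. -/
noncomputable def scalarCurvature (g : LorentzMetric n M) (p : M) : ℝ :=
  ∑ j, ∑ k, (metricCoeff g (chartAt E4 p) (chartAt E4 p p))⁻¹ j k *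
    ricciCoeff g (chartAt E4 p) j k (chartAt E4 p p)

/-- `(M, g)` solves the Einstein equations
`Ric - ½ R g = 8π ((ρ + p) u_* ⊗ u_* + p g)` with the perfect fluid `(u, ρ, p)`: here `u` is a
smooth unit timelike vector field and `u_* = g(u, ·)`. -/
structure IsPerfectFluidSolution (g : LorentzMetric n M)
    (u : ∀ x : M, TangentSpace 𝓘(ℝ, E4) x) (ρ p : M → ℝ) : Prop where
  smooth : ContMDiff 𝓘(ℝ, E4) (𝓘(ℝ, E4).tangent) ∞
    (fun x ↦ (⟨x, u x⟩ : TangentBundle 𝓘(ℝ, E4) M))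
  unit : ∀ x, g.val x (u x) (u x) = -1
  einstein : ∀ (x : M) (v w : TangentSpace 𝓘(ℝ, E4) x),
    ricci g x v w - 1 / 2 * scalarCurvature g x * g.val x v w =
      8 * Real.pi * ((ρ x + p x) * (g.val x (u x) v * g.val x (u x) w) + p x * g.val x v w)

end Curvature

section Conformal

variable {M : Type*} [TopologicalSpace M] [ChartedSpace E4 M] [IsManifold 𝓘(ℝ, E4) 1 M]
  {M' : Type*} [TopologicalSpace M'] [ChartedSpace E4 M'] [IsManifold 𝓘(ℝ, E4) 1 M']

/-- `∂₀M`: the points of the topological boundary of the image of `M` at which the conformal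
factor vanishes. -/
def conformalBoundary (ι : M → M') (Ω : M' → ℝ) : Set M' :=
  {q | q ∈ frontier (range ι) ∧ Ω q = 0}

/-- `(M', g')` is a `C⁰` conformal extension of the smooth spacetime `(M, g)`, through the
embedding `ι` and with the conformal factor `Ω`. Only the values of `Ω` on the closure of the image
of `M` are relevant. -/
structure IsC0ConformalExtension (g : Spacetime ∞ M) (g' : Spacetime 0 M') (ι : M → M')
    (Ω : M' → ℝ) : Prop where
  isOpenEmbedding : IsOpenEmbedding ι
  contMDiff_embedding : ContMDiff 𝓘(ℝ, E4) 𝓘(ℝ, E4) 1 ι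
  proper : range ι ≠ univ
  continuousOn : ContinuousOn Ω (closure (range ι))
  nonneg : ∀ q ∈ closure (range ι), 0 ≤ Ω q
  smooth : ContMDiff 𝓘(ℝ, E4) 𝓘(ℝ, ℝ) ∞ (fun p ↦ Ω (ι p))
  pos : ∀ p, 0 < Ω (ι p)
  boundary_nonempty : (conformalBoundary ι Ω).Nonempty
  conformal : ∀ (p : M) (v w : TangentSpace 𝓘(ℝ, E4) p),
    g'.val (ι p) (mfderiv 𝓘(ℝ, E4) 𝓘(ℝ, E4) ι p v) (mfderiv 𝓘(ℝ, E4) 𝓘(ℝ, E4) ι p w) =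
      Ω (ι p) ^ 2 * g.val p v w

/-- The past conformal boundary `∂₀⁻M`: the points `q` of `∂₀M` from which a future-directed
timelike curve of `M'` starts that runs in `M` except for its starting point (read backwards, a
past-directed timelike curve that terminates at `q`). -/
def pastConformalBoundary (g' : Spacetime 0 M') (ι : M → M') (Ω : M' → ℝ) : Set M' :=
  {q | q ∈ conformalBoundary ι Ω ∧ ∃ (a b : ℝ) (γ : ℝ → M'),
    g'.IsFutureTimelikeCurve γ a b ∧ γ a = q ∧ MapsTo γ (Ioc a b) (range ι)}

/-- `F` is the continuous extension of the function `f` on `M` to `M ∪ {O}`, where `M` is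
identified with its image under `ι`. The values of `F` outside `M ∪ {O}` are irrelevant. -/
def IsContinuousExtension (ι : M → M') (O : M') (f : M → ℝ) (F : M' → ℝ) : Prop :=
  ContinuousOn F (range ι ∪ {O}) ∧ ∀ p, F (ι p) = f p

/-- The tensor `S` of type `(0,2)` on `M` extends continuously to `M ∪ {O}`, and `L` is its
continuous extension at `O`: in some coordinates of `M'` around `O`, each component `S_{μν}`
extends continuously to `(U ∩ M) ∪ {O}`, where `U` is the coordinate domain, and the values of the
extensions at `O` are the components of `L`. -/
def BilinExtendsContinuously (ι : M → M') (O : M')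
    (S : ∀ p : M, TangentSpace 𝓘(ℝ, E4) p → TangentSpace 𝓘(ℝ, E4) p → ℝ)
    (L : TangentSpace 𝓘(ℝ, E4) O →L[ℝ] TangentSpace 𝓘(ℝ, E4) O →L[ℝ] ℝ) : Prop :=
  ∃ e ∈ IsManifold.maximalAtlas 𝓘(ℝ, E4) 1 M', O ∈ e.source ∧
    ∀ μ ν : Fin 4, ∃ F : M' → ℝ,
      ContinuousOn F (e.source ∩ range ι ∪ {O}) ∧
      (∀ p : M, ι p ∈ e.source →
        F (ι p) = S p ((mfderiv 𝓘(ℝ, E4) 𝓘(ℝ, E4) ι p).inverse (coordVec e (ι p) μ))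
          ((mfderiv 𝓘(ℝ, E4) 𝓘(ℝ, E4) ι p).inverse (coordVec e (ι p) ν))) ∧
      F O = L (coordVec e O μ) (coordVec e O ν)

end Conformal

/-! Let g̃ be the extended metric and Y = Ω⁻¹u the rescaled velocity, a g̃-unit vector. The Einstein
equations and their trace give Ω² Ric = 8π((ρ+p) Y♭⊗Y♭ + ½(ρ-p) g̃), with Y♭ = g̃(Y,·)
(`IsC0ConformalExtension.sq_mul_ricci_eq`). If ρ+p vanishes at O, take limits along one flow line of
Y: there Y♭ converges, the first term disappears, and ½(ρ-p) tends to the value of ρ at O. So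
everything rests on ρ+p = 0 at O.

Suppose ρ+p ≠ 0 at O. Dividing by it shows that Y♭⊗Y♭, hence Y⊗Y, converges at O from all of M
(`exists_tendsto_vecCoord_mul`). The limit is v⊗v, where v is the limiting velocity of one flow
line. Near O, then, Y lies in a narrow double cone around ±v. This contradicts the geometry of M =
I⁺(O) (`not_eventually_linearForms_mul_pos`): in coordinates, go a short way from O in a future
timelike direction w not parallel to v. The point reached lies in M, and the flow line through it
comes from O. Strong causality keeps that line near O, so its velocity stays in the double cone, and
the mean value theorem puts its total displacement, a multiple of w, in the closed double cone. The
cone can be chosen to miss w.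

The double cone is written φψ > 0 with two linear forms, because the sign of Y is not determined by
Y⊗Y and φ(Y)ψ(Y) is linear in Y⊗Y. -/

/-! ### Lorentzian linear algebra -/

section LorentzAlgebra

variable {n : WithTop ℕ∞} {M : Type*} [TopologicalSpace M] [ChartedSpace E4 M]
  [IsManifold 𝓘(ℝ, E4) 1 M]

/-- In a Lorentz frame, a Lorentzian metric is the Minkowski form. -/
theorem LorentzMetric.exists_coordinates (g : LorentzMetric n M) (p : M) :
    ∃ c : TangentSpace 𝓘(ℝ, E4) p ≃ₗ[ℝ] (Fin 4 → ℝ), ∀ v w, g.val p v w =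
      -(c v 0 * c w 0) + c v 1 * c w 1 + c v 2 * c w 2 + c v 3 * c w 3 := by
  obtain ⟨b, hb⟩ := g.lorentzian p
  refine ⟨b.equivFun, fun v w ↦ ?_⟩
  conv_lhs => rw [← b.sum_equivFun v, ← b.sum_equivFun w]
  simp only [map_sum, map_smul, FunLike.coe_sum, Finset.sum_apply,
    FunLike.coe_smul, Pi.smul_apply, hb, smul_eq_mul]
  simp [Fin.sum_univ_four]
  ring

theorem LorentzMetric.eq_zero_of_forall_apply_eq_zero (g : LorentzMetric n M) {p : M}
    {v : TangentSpace 𝓘(ℝ, E4) p} (h : ∀ w, g.val p v w = 0) : v = 0 := by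
  obtain ⟨c, hc⟩ := g.exists_coordinates p
  apply c.injective
  rw [map_zero]
  have key : ∀ i, c v i = 0 := by
    intro i
    have := h (c.symm (Pi.single i 1))
    rw [hc] at this
    fin_cases i <;> simpa using this
  exact funext key

/-- Timelike vectors are never orthogonal. -/
theorem LorentzMetric.IsTimelike.apply_ne_zero {g : LorentzMetric n M} {p : M}
    {v w : TangentSpace 𝓘(ℝ, E4) p} (hv : g.IsTimelike v) (hw : g.IsTimelike w) :
    g.val p v w ≠ 0 := by
  obtain ⟨c, hc⟩ := g.exists_coordinates p
  unfold LorentzMetric.IsTimelike at hv hw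
  rw [hc] at hv hw ⊢
  intro h
  set a := c v
  set b := c w
  have h0 : a 0 * b 0 = a 1 * b 1 + a 2 * b 2 + a 3 * b 3 := by linarith
  -- Cauchy–Schwarz for the spatial parts, through Lagrange's identity.
  have h1 : (a 0 * b 0) ^ 2 ≤ (a 1 ^ 2 + a 2 ^ 2 + a 3 ^ 2) * (b 1 ^ 2 + b 2 ^ 2 + b 3 ^ 2) := by
    rw [h0]
    nlinarith [sq_nonneg (a 1 * b 2 - a 2 * b 1), sq_nonneg (a 1 * b 3 - a 3 * b 1),
      sq_nonneg (a 2 * b 3 - a 3 * b 2)]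
  have h2 : (a 1 ^ 2 + a 2 ^ 2 + a 3 ^ 2) * (b 1 ^ 2 + b 2 ^ 2 + b 3 ^ 2) < a 0 ^ 2 * b 0 ^ 2 :=
    mul_lt_mul'' (by linarith [sq (a 0), sq (a 1), sq (a 2), sq (a 3)])
      (by linarith [sq (b 0), sq (b 1), sq (b 2), sq (b 3)]) (by positivity) (by positivity)
  nlinarith

theorem LorentzMetric.continuousOn_apply (g : LorentzMetric n M) {X : Type*} [TopologicalSpace X]
    {b : X → M} {v w : ∀ x, TangentSpace 𝓘(ℝ, E4) (b x)} {s : Set X}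
    (hv : ContinuousOn (fun x ↦ (⟨b x, v x⟩ : TangentBundle 𝓘(ℝ, E4) M)) s)
    (hw : ContinuousOn (fun x ↦ (⟨b x, w x⟩ : TangentBundle 𝓘(ℝ, E4) M)) s) :
    ContinuousOn (fun x ↦ g.val (b x) (v x) (w x)) s := by
  have hb : ContinuousOn b s :=
    (FiberBundle.continuous_proj E4 (TangentSpace 𝓘(ℝ, E4) (M := M))).comp_continuousOn hv
  have hg := g.contMDiff.continuous.comp_continuousOn hb
  have h : ContinuousOn (fun x ↦ TotalSpace.mk' (E := fun _ : M ↦ ℝ) ℝ (b x)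
      (g.val (b x) (v x) (w x))) s :=
    ContinuousOn.clm_bundle_apply₂ (F₁ := E4) (F₂ := E4) (F₃ := ℝ) hg hv hw
  exact ((Bundle.Trivial.homeomorphProd M ℝ).continuous.comp_continuousOn h).snd

end LorentzAlgebra

/-! ### Components of vectors and of the metric in a chart -/

section ChartCoordinates

variable {M : Type*} [TopologicalSpace M] [ChartedSpace E4 M] {e : OpenPartialHomeomorph M E4}

theorem mdifferentiable_of_mem_maximalAtlas_one
    (he : e ∈ IsManifold.maximalAtlas 𝓘(ℝ, E4) 1 M) :
    e.MDifferentiable 𝓘(ℝ, E4) 𝓘(ℝ, E4) :=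
  ⟨(contMDiffOn_of_mem_maximalAtlas he).mdifferentiableOn one_ne_zero,
    (contMDiffOn_symm_of_mem_maximalAtlas he).mdifferentiableOn one_ne_zero⟩

theorem vecCoord_mfderiv_symm (he : e ∈ IsManifold.maximalAtlas 𝓘(ℝ, E4) 1 M) {q : M}
    (hq : q ∈ e.source) (w : E4) (ν : Fin 4) :
    vecCoord e (q := q) (mfderiv 𝓘(ℝ, E4) 𝓘(ℝ, E4) e.symm (e q) w) ν = w ν := by
  have h := (mdifferentiable_of_mem_maximalAtlas_one he).comp_symm_deriv (e.map_source hq)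
  rw [e.left_inv hq] at h
  exact congrArg (fun z : E4 ↦ z ν) (DFunLike.congr_fun h w)

theorem sum_vecCoord_smul_coordVec (he : e ∈ IsManifold.maximalAtlas 𝓘(ℝ, E4) 1 M) {q : M}
    (hq : q ∈ e.source) (v : TangentSpace 𝓘(ℝ, E4) q) :
    ∑ μ, vecCoord e v μ • coordVec e q μ = v := by
  have h := (mdifferentiable_of_mem_maximalAtlas_one he).symm_comp_deriv hq
  have h2 := DFunLike.congr_fun h v
  refine Eq.trans ?_ h2
  set w : E4 := mfderiv 𝓘(ℝ, E4) 𝓘(ℝ, E4) e q v with hw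
  have hs : w = ∑ μ, w μ • EuclideanSpace.single μ (1 : ℝ) := by
    ext i
    simp [Fin.sum_univ_four]
    fin_cases i <;> simp
  have h3 : (mfderiv 𝓘(ℝ, E4) 𝓘(ℝ, E4) e.symm (e q)) w =
      ∑ μ, w μ • mfderiv 𝓘(ℝ, E4) 𝓘(ℝ, E4) e.symm (e q) (EuclideanSpace.single μ (1 : ℝ)) := by
    conv_lhs => rw [hs]
    exact (map_sum _ _ _).trans (Finset.sum_congr rfl fun μ _ ↦ map_smul _ _ _)
  exact h3.symm

theorem vecCoord_coordVec (he : e ∈ IsManifold.maximalAtlas 𝓘(ℝ, E4) 1 M) {q : M}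
    (hq : q ∈ e.source) (μ ν : Fin 4) :
    vecCoord e (coordVec e q μ) ν = if ν = μ then 1 else 0 :=
  (vecCoord_mfderiv_symm he hq (EuclideanSpace.single μ 1) ν).trans (by simp)

end ChartCoordinates

section Coordinates

variable {n : WithTop ℕ∞} {M : Type*} [TopologicalSpace M] [ChartedSpace E4 M]
  [IsManifold 𝓘(ℝ, E4) 1 M] {e : OpenPartialHomeomorph M E4}

theorem continuousOn_mfderiv_symm (he : e ∈ IsManifold.maximalAtlas 𝓘(ℝ, E4) 1 M) (w : E4) :
    ContinuousOn (fun y ↦ (⟨e.symm y, mfderiv 𝓘(ℝ, E4) 𝓘(ℝ, E4) e.symm y w⟩ :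
      TangentBundle 𝓘(ℝ, E4) M)) e.target := by
  have h := (contMDiffOn_symm_of_mem_maximalAtlas he).continuousOn_tangentMapWithin le_rfl
    e.open_target.uniqueMDiffOn
  have h2 : Continuous (fun y : E4 ↦ (⟨y, w⟩ : TangentBundle 𝓘(ℝ, E4) E4)) :=
    (tangentBundleModelSpaceHomeomorph 𝓘(ℝ, E4)).symm.continuous.comp
      (continuous_id.prodMk continuous_const)
  refine (h.comp h2.continuousOn (fun y hy ↦ hy)).congr fun y hy ↦ ?_
  simp only [Function.comp, tangentMapWithin]
  rw [mfderivWithin_of_isOpen e.open_target hy]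

theorem continuousOn_coordVec (he : e ∈ IsManifold.maximalAtlas 𝓘(ℝ, E4) 1 M) (μ : Fin 4) :
    ContinuousOn (fun q ↦ (⟨q, coordVec e q μ⟩ : TangentBundle 𝓘(ℝ, E4) M)) e.source := by
  refine ((continuousOn_mfderiv_symm he (EuclideanSpace.single μ (1 : ℝ))).comp e.continuousOn
    e.mapsTo).congr fun q hq ↦ ?_
  simp only [Function.comp]
  unfold coordVec
  rw [e.left_inv hq]

/-- The components of a tangent vector in a chart depend continuously on the vector. -/
theorem continuousOn_vecCoord (he : e ∈ IsManifold.maximalAtlas 𝓘(ℝ, E4) 1 M) (μ : Fin 4) :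
    ContinuousOn (fun v : TangentBundle 𝓘(ℝ, E4) M ↦ vecCoord e v.2 μ)
      (TotalSpace.proj ⁻¹' e.source) := by
  have h := (contMDiffOn_of_mem_maximalAtlas he).continuousOn_tangentMapWithin le_rfl
    e.open_source.uniqueMDiffOn
  have h2 := (tangentBundleModelSpaceHomeomorph 𝓘(ℝ, E4)).continuous.comp_continuousOn h
  refine ((EuclideanSpace.proj (𝕜 := ℝ) μ).continuous.comp_continuousOn h2.snd).congr fun v hv ↦ ?_
  simp only [Function.comp, tangentMapWithin]
  rw [mfderivWithin_of_isOpen e.open_source hv]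
  rfl

/-- The Gram matrix `g(∂_μ, ∂_ν)` as a function on the manifold. -/
noncomputable def gramMatrix (g : LorentzMetric n M) (e : OpenPartialHomeomorph M E4) (q : M) :
    Matrix (Fin 4) (Fin 4) ℝ :=
  Matrix.of fun μ ν ↦ g.val q (coordVec e q μ) (coordVec e q ν)

theorem apply_coordVec (g : LorentzMetric n M) (he : e ∈ IsManifold.maximalAtlas 𝓘(ℝ, E4) 1 M)
    {q : M} (hq : q ∈ e.source) (v : TangentSpace 𝓘(ℝ, E4) q) (ν : Fin 4) :
    g.val q v (coordVec e q ν) = ∑ μ, gramMatrix g e q ν μ * vecCoord e v μ := by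
  conv_lhs => rw [← sum_vecCoord_smul_coordVec he hq v]
  simp only [map_sum, map_smul, FunLike.coe_sum, Finset.sum_apply,
    FunLike.coe_smul, Pi.smul_apply, smul_eq_mul, gramMatrix, Matrix.of_apply]
  exact Finset.sum_congr rfl fun μ _ ↦ by rw [g.symm q (coordVec e q ν), mul_comm]

/-- A kernel vector of the Gram matrix is the component vector of a tangent vector orthogonal to
every coordinate vector, hence to everything. -/
theorem det_gramMatrix_ne_zero (g : LorentzMetric n M)
    (he : e ∈ IsManifold.maximalAtlas 𝓘(ℝ, E4) 1 M) {q : M} (hq : q ∈ e.source) :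
    (gramMatrix g e q).det ≠ 0 := by
  intro h
  obtain ⟨c, hc, hc0⟩ := Matrix.exists_mulVec_eq_zero_iff.2 h
  apply hc
  set w : E4 := WithLp.toLp 2 c
  set v : TangentSpace 𝓘(ℝ, E4) q := mfderiv 𝓘(ℝ, E4) 𝓘(ℝ, E4) e.symm (e q) w
  have hv : ∀ ν, vecCoord e v ν = c ν := vecCoord_mfderiv_symm he hq w
  have h0 : v = 0 := by
    refine g.eq_zero_of_forall_apply_eq_zero fun z ↦ ?_
    rw [← sum_vecCoord_smul_coordVec he hq z, map_sum]
    refine Finset.sum_eq_zero fun ν _ ↦ ?_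
    rw [map_smul, apply_coordVec g he hq]
    simp only [hv]
    have := congrFun hc0 ν
    simp only [Matrix.mulVec, dotProduct, Pi.zero_apply] at this
    rw [this, smul_zero]
  funext ν
  rw [← hv, h0]
  simp only [vecCoord, map_zero]
  rfl

theorem continuousOn_gramMatrix (g : LorentzMetric n M)
    (he : e ∈ IsManifold.maximalAtlas 𝓘(ℝ, E4) 1 M) : ContinuousOn (gramMatrix g e) e.source :=
  continuousOn_pi.2 fun μ ↦ continuousOn_pi.2 fun ν ↦
    g.continuousOn_apply (continuousOn_coordVec he μ) (continuousOn_coordVec he ν)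

theorem vecCoord_eq_inv_mulVec (g : LorentzMetric n M)
    (he : e ∈ IsManifold.maximalAtlas 𝓘(ℝ, E4) 1 M)
    {q : M} (hq : q ∈ e.source) (v : TangentSpace 𝓘(ℝ, E4) q) :
    vecCoord e v = (gramMatrix g e q)⁻¹.mulVec fun ν ↦ g.val q v (coordVec e q ν) := by
  have h : (fun ν ↦ g.val q v (coordVec e q ν)) = (gramMatrix g e q).mulVec (vecCoord e v) :=
    funext fun ν ↦ apply_coordVec g he hq v ν
  rw [h, Matrix.mulVec_mulVec, Matrix.nonsing_inv_mul _
    (isUnit_iff_ne_zero.2 (det_gramMatrix_ne_zero g he hq)), Matrix.one_mulVec]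

end Coordinates

/-! ### Ricci curvature of a perfect fluid -/

section Fluid

variable {n : WithTop ℕ∞} {M : Type*} [TopologicalSpace M] [ChartedSpace E4 M]
  [IsManifold 𝓘(ℝ, E4) 1 M]

/-- The trace of the Einstein equations. -/
theorem IsPerfectFluidSolution.scalarCurvature_eq {g : LorentzMetric n M}
    {u : ∀ x : M, TangentSpace 𝓘(ℝ, E4) x} {ρ p : M → ℝ} (h : IsPerfectFluidSolution g u ρ p)
    (x : M) : scalarCurvature g x = 8 * Real.pi * (ρ x - 3 * p x) := by
  set e := chartAt E4 x with he'
  have he : e ∈ IsManifold.maximalAtlas 𝓘(ℝ, E4) 1 M := IsManifold.chart_mem_maximalAtlas x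
  have hx : x ∈ e.source := mem_chart_source E4 x
  have hG : metricCoeff g e (e x) = gramMatrix g e x := by
    unfold metricCoeff gramMatrix
    rw [e.left_inv hx]
  set G := gramMatrix g e x with hGdef
  have hdet : IsUnit G.det := isUnit_iff_ne_zero.2 (det_gramMatrix_ne_zero g he hx)
  set U : Fin 4 → ℝ := fun ν ↦ g.val x (u x) (coordVec e x ν) with hU
  have hV : vecCoord e (u x) = G⁻¹.mulVec U := vecCoord_eq_inv_mulVec g he hx (u x)
  have hric : ∀ j k, ricciCoeff g e j k (e x) = 1 / 2 * scalarCurvature g x * G j k +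
      8 * Real.pi * ((ρ x + p x) * (U j * U k) + p x * G j k) := by
    intro j k
    have h1 := h.einstein x (coordVec e x j) (coordVec e x k)
    have h2 : ricci g x (coordVec e x j) (coordVec e x k) = ricciCoeff g e j k (e x) := by
      unfold ricci
      simp only [← he', vecCoord_coordVec he hx]
      simp
    rw [h2] at h1
    simp only [hU, hGdef, gramMatrix, Matrix.of_apply]
    linarith
  have hsym : ∀ j k, G j k = G k j := fun j k ↦ g.symm x _ _
  have htr : ∑ j, ∑ k, G⁻¹ j k * G j k = 4 := by
    have h1 := congrArg Matrix.trace (Matrix.nonsing_inv_mul G hdet)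
    simp only [Matrix.trace, Matrix.diag, Matrix.mul_apply, Matrix.one_apply_eq] at h1
    simp only [Finset.sum_const, Finset.card_univ, Fintype.card_fin] at h1
    rw [← show (4 • (1 : ℝ)) = 4 by norm_num, ← h1]
    exact Finset.sum_congr rfl fun j _ ↦ Finset.sum_congr rfl fun k _ ↦ by rw [hsym j k]
  -- The inverse metric applied twice to u_* is g(u,u).
  have hnorm : ∑ j, ∑ k, G⁻¹ j k * (U j * U k) = -1 := by
    have h1 : g.val x (u x) (u x) = ∑ j, vecCoord e (u x) j * U j := by
      conv_lhs => rw [← sum_vecCoord_smul_coordVec he hx (u x)]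
      rw [map_sum, sum_vecCoord_smul_coordVec he hx (u x)]
      exact Finset.sum_congr rfl fun j _ ↦ by rw [map_smul, smul_eq_mul]
    rw [← h.unit x, h1, hV]
    refine Finset.sum_congr rfl fun j _ ↦ ?_
    rw [Matrix.mulVec, dotProduct, Finset.sum_mul]
    exact Finset.sum_congr rfl fun k _ ↦ by ring
  have hR : scalarCurvature g x = ∑ j, ∑ k, G⁻¹ j k * ricciCoeff g e j k (e x) := by
    rw [← hG]; rfl
  -- With the two contractions 4 and -1 this becomes a linear equation for R, namely R = 2R + 32πp -
  -- 8π(ρ+p).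
  have hexp : ∑ j, ∑ k, G⁻¹ j k * ricciCoeff g e j k (e x) =
      (1 / 2 * scalarCurvature g x + 8 * Real.pi * p x) * ∑ j, ∑ k, G⁻¹ j k * G j k +
      8 * Real.pi * (ρ x + p x) * ∑ j, ∑ k, G⁻¹ j k * (U j * U k) := by
    simp only [hric, Finset.mul_sum, ← Finset.sum_add_distrib]
    exact Finset.sum_congr rfl fun j _ ↦ Finset.sum_congr rfl fun k _ ↦ by ring
  rw [htr, hnorm] at hexp
  rw [hexp] at hR
  linarith

theorem IsPerfectFluidSolution.ricci_eq {g : LorentzMetric n M}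
    {u : ∀ x : M, TangentSpace 𝓘(ℝ, E4) x} {ρ p : M → ℝ} (h : IsPerfectFluidSolution g u ρ p)
    (x : M) (v w : TangentSpace 𝓘(ℝ, E4) x) :
    ricci g x v w = 8 * Real.pi * ((ρ x + p x) * (g.val x (u x) v * g.val x (u x) w) +
      (ρ x - p x) / 2 * g.val x v w) := by
  have h1 := h.einstein x v w
  rw [h.scalarCurvature_eq x] at h1
  linarith

end Fluid

/-! ### Existence of maximal integral curves -/

section IntegralCurves

variable {M : Type*} [TopologicalSpace M] [ChartedSpace E4 M]

theorem IsMIntegralCurveAt.congr_of_eventuallyEq {X : ∀ p : M, TangentSpace 𝓘(ℝ, E4) p}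
    {γ γ' : ℝ → M} {t : ℝ} (h : IsMIntegralCurveAt γ X t) (heq : γ' =ᶠ[𝓝 t] γ) :
    IsMIntegralCurveAt γ' X t := by
  filter_upwards [h, heq.eventuallyEq_nhds] with s hs hs'
  have h1 := hs.congr_of_eventuallyEq hs'
  -- The velocities lie in tangent spaces at formally different points; they are compared in the
  -- model space, to which all tangent spaces unfold.
  have h2 : (X (γ s) : E4) = X (γ' s) := congrArg (fun y ↦ (X y : E4)) hs'.self_of_nhds.symm
  have h3 : ((1 : ℝ →L[ℝ] ℝ).smulRight (X (γ s)) : ℝ →L[ℝ] E4) =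
    (1 : ℝ →L[ℝ] ℝ).smulRight (X (γ' s)) := congrArg _ h2
  exact h3 ▸ h1

/-- Every point lies on a maximal integral curve of a `C¹` vector field. -/
theorem exists_isMaximalIntegralCurve [IsManifold 𝓘(ℝ, E4) 1 M]
    {X : ∀ p : M, TangentSpace 𝓘(ℝ, E4) p}
    (hX : ContMDiff 𝓘(ℝ, E4) (𝓘(ℝ, E4).tangent) 1
      (fun x ↦ (⟨x, X x⟩ : TangentBundle 𝓘(ℝ, E4) M))) (q : M) :
    ∃ (γ : ℝ → M) (J : Set ℝ), IsMaximalIntegralCurve X γ J ∧ 0 ∈ J ∧ γ 0 = q := by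
  -- Zorn's lemma for curves through q at time 0, preordered by extension. Members of a chain agree
  -- on common domains by definition, so gluing them needs no uniqueness theorem for integral
  -- curves. The empty chain is bounded by a local solution.
  let α := {P : (ℝ → M) × Set ℝ // IsOpen P.2 ∧ P.2.OrdConnected ∧ 0 ∈ P.2 ∧ P.1 0 = q ∧
    IsMIntegralCurveOn P.1 X P.2}
  let r : α → α → Prop := fun a b ↦ a.1.2 ⊆ b.1.2 ∧ EqOn a.1.1 b.1.1 a.1.2
  have hchain : ∀ c : Set α, IsChain r c → ∃ ub, ∀ a ∈ c, r a ub := by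
    intro c hc
    rcases c.eq_empty_or_nonempty with rfl | ⟨a₀, ha₀⟩
    · obtain ⟨γ, hγ, hcurve⟩ := exists_isMIntegralCurveAt_of_contMDiffAt_boundaryless
        (I := 𝓘(ℝ, E4)) 0 (hX q)
      obtain ⟨ε, hε, hball⟩ := isMIntegralCurveAt_iff'.1 hcurve
      exact ⟨⟨(γ, Metric.ball 0 ε), Metric.isOpen_ball, (convex_ball 0 ε).ordConnected,
        Metric.mem_ball_self hε, hγ, hball⟩, fun a ha ↦ ha.elim⟩
    · classical
      let J : Set ℝ := ⋃ a ∈ c, a.1.2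
      let Γ : ℝ → M := fun t ↦ if h : ∃ a ∈ c, t ∈ a.1.2 then h.choose.1.1 t else q
      have hΓ : ∀ a ∈ c, EqOn a.1.1 Γ a.1.2 := by
        intro a ha t ht
        have h : ∃ a ∈ c, t ∈ a.1.2 := ⟨a, ha, ht⟩
        have hdef : Γ t = h.choose.1.1 t := dif_pos h
        rw [hdef]
        by_cases hne : a = h.choose
        · rw [← hne]
        · rcases hc ha h.choose_spec.1 hne with h1 | h1
          · exact h1.2 ht
          · exact (h1.2 h.choose_spec.2).symm
      have hJopen : IsOpen J := isOpen_biUnion fun a _ ↦ a.2.1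
      refine ⟨⟨(Γ, J), hJopen, ?_, ?_, ?_, ?_⟩, fun a ha ↦
        ⟨subset_biUnion_of_mem (u := fun a : α ↦ a.1.2) ha, hΓ a ha⟩⟩
      · refine isPreconnected_iff_ordConnected.1 ?_
        have hJ : J = ⋃₀ ((fun a : α ↦ a.1.2) '' c) := (sUnion_image _ _).symm
        rw [hJ]
        refine isPreconnected_sUnion 0 _ ?_ ?_
        · rintro _ ⟨a, -, rfl⟩
          exact a.2.2.2.1
        · rintro _ ⟨a, -, rfl⟩
          exact isPreconnected_iff_ordConnected.2 a.2.2.1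
      · exact mem_biUnion ha₀ a₀.2.2.2.1
      · exact (hΓ a₀ ha₀ a₀.2.2.2.1).symm.trans a₀.2.2.2.2.1
      · refine (isMIntegralCurveOn_iff_isMIntegralCurveAt hJopen).2 fun t ht ↦ ?_
        obtain ⟨a, ha, hta⟩ := mem_iUnion₂.1 ht
        have hmem := a.2.1.mem_nhds hta
        exact (a.2.2.2.2.2.isMIntegralCurveAt hmem).congr_of_eventuallyEq
          (Filter.eventuallyEq_of_mem hmem fun s hs ↦ (hΓ a ha hs).symm)
  obtain ⟨m, hm⟩ := exists_maximal_of_chains_bounded hchain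
    fun {a b c} hab hbc ↦ ⟨hab.1.trans hbc.1, fun t ht ↦ (hab.2 ht).trans (hbc.2 (hab.1 ht))⟩
  refine ⟨m.1.1, m.1.2, ⟨m.2.1, m.2.2.1, ⟨0, m.2.2.2.1⟩, m.2.2.2.2.2, ?_⟩, m.2.2.2.1,
    m.2.2.2.2.1⟩
  intro γ' J' hJ' hJ'c hγ' hsub heq
  exact ((hm ⟨(γ', J'), hJ', hJ'c, hsub m.2.2.2.1,
    (heq m.2.2.2.1).symm.trans m.2.2.2.2.1, hγ'⟩ ⟨hsub, heq⟩).1).antisymm hsub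

end IntegralCurves

/-! ### Timelike curves and strong causality -/

section Curves

variable {M : Type*} [TopologicalSpace M] [ChartedSpace E4 M]
  {c : ℝ → M} {w : ∀ t, TangentSpace 𝓘(ℝ, E4) (c t)} {J : Set ℝ}

theorem isPiecewiseC1With_of_hasMFDerivAt {P : ∀ p : M, TangentSpace 𝓘(ℝ, E4) p → Prop}
    (h : ∀ t ∈ J, HasMFDerivAt 𝓘(ℝ, ℝ) 𝓘(ℝ, E4) c t ((1 : ℝ →L[ℝ] ℝ).smulRight (w t)))
    (hc : ContMDiffOn 𝓘(ℝ, ℝ) 𝓘(ℝ, E4) 1 c J)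
    {a b : ℝ} (hab : a < b) (hsub : Icc a b ⊆ J) (hP : ∀ t ∈ Icc a b, P (c t) (w t)) :
    IsPiecewiseC1With P c a b := by
  -- A single piece: the partition is a, b.
  refine ⟨hab, 1, fun i ↦ if i = 0 then a else b, by simp, by simp, fun i hi ↦ ?_⟩
  obtain rfl : i = 0 := by omega
  simp only [if_true, zero_add, one_ne_zero, if_false]
  refine ⟨hab, hc.mono hsub, fun s hs ↦ ?_⟩
  have h1 := ((h s (hsub hs)).hasMFDerivWithinAt (s := Icc a b)).mfderivWithin
    ((uniqueDiffOn_Icc hab).uniqueMDiffOn s hs)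
  rw [h1]
  have h2 : ((1 : ℝ →L[ℝ] ℝ).smulRight (w s)) (1 : ℝ) = w s := one_smul ℝ (w s)
  exact h2.symm ▸ hP s hs

theorem hasDerivAt_chart_comp {e : OpenPartialHomeomorph M E4}
    (he : e ∈ IsManifold.maximalAtlas 𝓘(ℝ, E4) 1 M) {t : ℝ} (ht : c t ∈ e.source)
    (h : HasMFDerivAt 𝓘(ℝ, ℝ) 𝓘(ℝ, E4) c t ((1 : ℝ →L[ℝ] ℝ).smulRight (w t))) :
    HasDerivAt (fun s ↦ e (c s)) (WithLp.toLp 2 (vecCoord e (w t)) : E4) t := by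
  have h1 := (((mdifferentiable_of_mem_maximalAtlas_one he).mdifferentiableAt ht).hasMFDerivAt).comp
    t h
  have h2 : ((mfderiv 𝓘(ℝ, E4) 𝓘(ℝ, E4) e (c t)).comp ((1 : ℝ →L[ℝ] ℝ).smulRight (w t)) :
      ℝ →L[ℝ] E4) = (1 : ℝ →L[ℝ] ℝ).smulRight (WithLp.toLp 2 (vecCoord e (w t)) : E4) := by
    refine ContinuousLinearMap.ext_ring ?_
    exact (congrArg (mfderiv 𝓘(ℝ, E4) 𝓘(ℝ, E4) e (c t)) (one_smul ℝ (w t))).trans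
      (one_smul ℝ (WithLp.toLp 2 (vecCoord e (w t)) : E4)).symm
  have h3 : HasFDerivAt (fun s ↦ e (c s))
      ((1 : ℝ →L[ℝ] ℝ).smulRight (WithLp.toLp 2 (vecCoord e (w t)) : E4)) t := by
    rw [← h2]
    exact hasMFDerivAt_iff_hasFDerivAt.1 h1
  simpa using h3.hasDerivAt

variable [IsManifold 𝓘(ℝ, E4) 1 M]

/-- A curve with a continuous velocity is `C¹`. -/
theorem contMDiffOn_one_of_hasMFDerivAt (hJ : IsOpen J)
    (h : ∀ t ∈ J, HasMFDerivAt 𝓘(ℝ, ℝ) 𝓘(ℝ, E4) c t ((1 : ℝ →L[ℝ] ℝ).smulRight (w t)))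
    (hw : ContinuousOn (fun t ↦ (⟨c t, w t⟩ : TangentBundle 𝓘(ℝ, E4) M)) J) :
    ContMDiffOn 𝓘(ℝ, ℝ) 𝓘(ℝ, E4) 1 c J := by
  intro t ht
  refine ContMDiffAt.contMDiffWithinAt ?_
  have he : chartAt E4 (c t) ∈ IsManifold.maximalAtlas 𝓘(ℝ, E4) 1 M :=
    IsManifold.chart_mem_maximalAtlas _
  set e := chartAt E4 (c t)
  have hct : ContinuousAt c t := (h t ht).continuousAt
  have hcont : ContinuousOn c J := fun s hs ↦ (h s hs).continuousAt.continuousWithinAt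
  rw [contMDiffAt_iff_target]
  refine ⟨hct, ?_⟩
  rw [contMDiffAt_iff_contDiffAt, contDiffAt_one_iff]
  have hU : IsOpen (J ∩ c ⁻¹' e.source) := hcont.isOpen_inter_preimage hJ e.open_source
  refine ⟨fun s ↦ (1 : ℝ →L[ℝ] ℝ).smulRight (WithLp.toLp 2 (vecCoord e (w s)) : E4),
    J ∩ c ⁻¹' e.source, hU.mem_nhds ⟨ht, mem_chart_source E4 (c t)⟩, ?_, fun s hs ↦ ?_⟩
  · have h1 : ContinuousOn (fun s ↦ (WithLp.toLp 2 (vecCoord e (w s)) : E4))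
        (J ∩ c ⁻¹' e.source) := by
      refine (PiLp.continuous_toLp 2 _).comp_continuousOn (continuousOn_pi.2 fun μ ↦ ?_)
      exact (continuousOn_vecCoord he μ).comp (hw.mono inter_subset_left) fun s hs ↦ hs.2
    exact ((ContinuousLinearMap.smulRightL ℝ ℝ E4 1).continuous).comp_continuousOn h1
  · exact (hasDerivAt_chart_comp he hs.2 (h s hs.1)).hasFDerivAt

/-- Strong causality applies to timelike curves irrespective of their time orientation. -/
theorem Spacetime.IsStronglyCausalAt.exists_mapsTo {n : WithTop ℕ∞} {S : Spacetime n M} {q : M}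
    (hS : S.IsStronglyCausalAt q) {U : Set M} (hU : U ∈ 𝓝 q) :
    ∃ V ∈ 𝓝 q, ∀ (c : ℝ → M) (w : ∀ t, TangentSpace 𝓘(ℝ, E4) (c t)) (J : Set ℝ), IsOpen J →
      J.OrdConnected →
      (∀ t ∈ J, HasMFDerivAt 𝓘(ℝ, ℝ) 𝓘(ℝ, E4) c t ((1 : ℝ →L[ℝ] ℝ).smulRight (w t))) →
      ContinuousOn (fun t ↦ (⟨c t, w t⟩ : TangentBundle 𝓘(ℝ, E4) M)) J →
      (∀ t ∈ J, S.IsTimelike (w t)) →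
      ∀ a ∈ J, ∀ b ∈ J, a < b → c a ∈ V → c b ∈ V → MapsTo c (Icc a b) U := by
  obtain ⟨V, hV, -, hVU⟩ := hS U hU
  refine ⟨V, hV, fun c w J hJ hJc h hw htl a ha b hb hab hca hcb ↦ ?_⟩
  have hcont : ContinuousOn c J := fun s hs ↦ (h s hs).continuousAt.continuousWithinAt
  have hsub : Icc a b ⊆ J := hJc.out ha hb
  have hne0 : ∀ t ∈ J, w t ≠ 0 := by
    intro t ht h0
    have := htl t ht
    rw [LorentzMetric.IsTimelike, h0, map_zero] at this
    exact lt_irrefl _ this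
  have hne : ∀ t ∈ J, S.val (c t) (w t) (S.timeField (c t)) ≠ 0 := fun t ht ↦
    (htl t ht).apply_ne_zero (S.timeField_timelike (c t))
  have hf : ContinuousOn (fun t ↦ S.val (c t) (w t) (S.timeField (c t))) J :=
    S.continuousOn_apply hw (S.timeField_continuous.comp_continuousOn hcont)
  -- The product with the time orientation is continuous and never zero on an interval, so it has
  -- one sign.
  have hsign : (∀ t ∈ J, S.val (c t) (w t) (S.timeField (c t)) < 0) ∨
      ∀ t ∈ J, 0 < S.val (c t) (w t) (S.timeField (c t)) := by
    by_contra! hcon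
    obtain ⟨⟨s, hs, hs0⟩, t, ht, ht0⟩ := hcon
    obtain ⟨r, hr, hr0⟩ := hJc.isPreconnected.intermediate_value ht hs hf ⟨ht0, hs0⟩
    exact hne r hr hr0
  have hC1 := contMDiffOn_one_of_hasMFDerivAt hJ h hw
  rcases hsign with hsign | hsign
  · exact hVU a b c (isPiecewiseC1With_of_hasMFDerivAt h hC1 hab hsub fun t ht ↦
      ⟨hne0 t (hsub ht), (htl t (hsub ht)).le, hsign t (hsub ht)⟩) hca hcb
  -- A past-directed curve is run backwards, which exchanges its endpoints; the conclusion concerns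
  -- only its image.
  · have hneg : Continuous (fun t : ℝ ↦ -t) := continuous_neg
    have hsub' : Icc (-b) (-a) ⊆ (fun t ↦ -t) ⁻¹' J := fun t ht ↦
      hsub ⟨le_neg_of_le_neg ht.2, neg_le.1 ht.1⟩
    have hder : ∀ t ∈ (fun t : ℝ ↦ -t) ⁻¹' J, HasMFDerivAt 𝓘(ℝ, ℝ) 𝓘(ℝ, E4) (fun t ↦ c (-t)) t
        ((1 : ℝ →L[ℝ] ℝ).smulRight (-w (-t))) := by
      intro t ht
      have h1 : HasMFDerivAt 𝓘(ℝ, ℝ) 𝓘(ℝ, ℝ) (fun t : ℝ ↦ -t) t (-1 : ℝ →L[ℝ] ℝ) :=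
        (hasFDerivAt_id t).neg.hasMFDerivAt
      have h2 := (h (-t) ht).comp t h1
      have h3 : ((1 : ℝ →L[ℝ] ℝ).smulRight (w (-t))).comp (-1 : ℝ →L[ℝ] ℝ) =
          (1 : ℝ →L[ℝ] ℝ).smulRight (-w (-t)) := by
        ext
        simp
      rw [← h3]
      exact h2
    have hC1' : ContMDiffOn 𝓘(ℝ, ℝ) 𝓘(ℝ, E4) 1 (fun t ↦ c (-t)) ((fun t : ℝ ↦ -t) ⁻¹' J) :=
      hC1.comp (contDiff_neg.contMDiff.contMDiffOn) fun t ht ↦ ht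
    have h4 := hVU (-b) (-a) (fun t ↦ c (-t)) (isPiecewiseC1With_of_hasMFDerivAt
      hder hC1' (neg_lt_neg hab) hsub' fun t ht ↦ by
        have ht' := hsub' ht
        refine ⟨neg_ne_zero.2 (hne0 _ ht'), ?_, ?_⟩
        · simpa using (htl _ ht').le
        · simpa using hsign _ ht') (by simpa using hcb) (by simpa using hca)
    intro t ht
    simpa using h4 (x := -t) ⟨neg_le_neg ht.2, neg_le_neg ht.1⟩

end Curves

/-! ### Timelike directions at a point and cones separating them -/

/-- Being future timelike is an open condition, so a short piece of the coordinate ray with initial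
velocity w is itself a timelike curve. With M = I⁺(O) this supplies points of M arbitrarily near O
in every future timelike direction. -/
theorem Spacetime.eventually_mem_timelikeFuture {n : WithTop ℕ∞} {M : Type*} [TopologicalSpace M]
    [ChartedSpace E4 M] [IsManifold 𝓘(ℝ, E4) 1 M] (S : Spacetime n M)
    {e : OpenPartialHomeomorph M E4} (he : e ∈ IsManifold.maximalAtlas 𝓘(ℝ, E4) 1 M) {q : M}
    (hq : q ∈ e.source) (w : E4)
    (hw : S.IsFutureTimelike q (mfderiv 𝓘(ℝ, E4) 𝓘(ℝ, E4) e.symm (e q) w)) :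
    ∀ᶠ s : ℝ in 𝓝[>] 0, e.symm (e q + s • w) ∈ S.timelikeFuture q univ := by
  set y : ℝ → E4 := fun t ↦ e q + t • w with hy
  have hyc : Continuous y := by fun_prop
  set J : Set ℝ := y ⁻¹' e.target
  have hJ : IsOpen J := e.open_target.preimage hyc
  have h0J : (0 : ℝ) ∈ J := by simp [J, hy, e.map_source hq]
  have hder : ∀ t ∈ J, HasMFDerivAt 𝓘(ℝ, ℝ) 𝓘(ℝ, E4) (fun t ↦ e.symm (y t)) t
      ((1 : ℝ →L[ℝ] ℝ).smulRight
        (mfderiv 𝓘(ℝ, E4) 𝓘(ℝ, E4) e.symm (y t) w : TangentSpace 𝓘(ℝ, E4) (e.symm (y t)))) := by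
    intro t ht
    have h1 : HasMFDerivAt 𝓘(ℝ, ℝ) 𝓘(ℝ, E4) y t ((1 : ℝ →L[ℝ] ℝ).smulRight w) := by
      refine HasFDerivAt.hasMFDerivAt ?_
      have h := ((hasDerivAt_id t).smul_const w).const_add (e q)
      rw [one_smul] at h
      exact h.hasFDerivAt
    have h2 := (((mdifferentiable_of_mem_maximalAtlas_one he).symm.mdifferentiableAt
      ht).hasMFDerivAt).comp t h1
    have h3 : ((mfderiv 𝓘(ℝ, E4) 𝓘(ℝ, E4) e.symm (y t)).comp
        ((1 : ℝ →L[ℝ] ℝ).smulRight w : ℝ →L[ℝ] E4) : ℝ →L[ℝ] E4) =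
        (1 : ℝ →L[ℝ] ℝ).smulRight (mfderiv 𝓘(ℝ, E4) 𝓘(ℝ, E4) e.symm (y t) w : E4) := by
      refine ContinuousLinearMap.ext_ring ?_
      exact (congrArg (mfderiv 𝓘(ℝ, E4) 𝓘(ℝ, E4) e.symm (y t)) (one_smul ℝ w)).trans
        (one_smul ℝ (mfderiv 𝓘(ℝ, E4) 𝓘(ℝ, E4) e.symm (y t) w : E4)).symm
    exact h3 ▸ h2
  have hlift : ContinuousOn (fun t ↦ (⟨e.symm (y t), mfderiv 𝓘(ℝ, E4) 𝓘(ℝ, E4) e.symm (y t) w⟩ :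
      TangentBundle 𝓘(ℝ, E4) M)) J :=
    (continuousOn_mfderiv_symm he w).comp hyc.continuousOn fun t ht ↦ ht
  have hC1 := contMDiffOn_one_of_hasMFDerivAt hJ hder hlift
  have hcont : ContinuousOn (fun t ↦ e.symm (y t)) J := hC1.continuousOn
  have hf1 := (S.continuousOn_apply hlift hlift).continuousAt (hJ.mem_nhds h0J)
  have hf2 := (S.continuousOn_apply hlift
    (S.timeField_continuous.comp_continuousOn hcont)).continuousAt (hJ.mem_nhds h0J)
  have hy0 : y 0 = e q := by simp [hy]
  have hev : ∀ᶠ t in 𝓝 (0 : ℝ), t ∈ J ∧ S.IsFutureTimelike (e.symm (y t))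
      (mfderiv 𝓘(ℝ, E4) 𝓘(ℝ, E4) e.symm (y t) w) := by
    refine Filter.Eventually.and (hJ.mem_nhds h0J) (Filter.Eventually.and ?_ ?_)
    · refine hf1.eventually_lt_const ?_
      beta_reduce
      rw [hy0, e.left_inv hq]
      exact hw.1
    · refine hf2.eventually_lt_const ?_
      beta_reduce
      rw [hy0, e.left_inv hq]
      exact hw.2
  obtain ⟨δ, hδ, hball⟩ := Metric.eventually_nhds_iff_ball.1 hev
  filter_upwards [Ioo_mem_nhdsGT hδ] with s hs
  have hsub : ∀ t ∈ Icc 0 s, t ∈ Metric.ball (0 : ℝ) δ := fun t ht ↦ by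
    rw [Metric.mem_ball, Real.dist_0_eq_abs, abs_of_nonneg ht.1]
    exact ht.2.trans_lt hs.2
  refine ⟨mem_univ _, 0, s, fun t ↦ e.symm (y t), ?_, mapsTo_univ _ _, ?_, rfl⟩
  · exact isPiecewiseC1With_of_hasMFDerivAt hder hC1 hs.1 (fun t ht ↦ (hball t (hsub t ht)).1)
      fun t ht ↦ (hball t (hsub t ht)).2
  · simp only [hy0, e.left_inv hq]

/-- The future-directed timelike vectors do not lie on a line. -/
theorem Spacetime.exists_isFutureTimelike_notMem_span {n : WithTop ℕ∞} {M : Type*}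
    [TopologicalSpace M] [ChartedSpace E4 M] [IsManifold 𝓘(ℝ, E4) 1 M] (S : Spacetime n M) (q : M)
    (v : TangentSpace 𝓘(ℝ, E4) q) :
    ∃ w : TangentSpace 𝓘(ℝ, E4) q, S.IsFutureTimelike q w ∧ w ∉ Submodule.span ℝ {v} := by
  have hT := S.timeField_timelike q
  by_cases h : S.timeField q ∈ Submodule.span ℝ {v}
  swap
  · exact ⟨S.timeField q, ⟨hT, hT⟩, h⟩
  have hlt : Submodule.span ℝ {v} ≠ ⊤ := by
    intro htop
    have h1 := finrank_span_le_card (R := ℝ) ({v} : Set (TangentSpace 𝓘(ℝ, E4) q))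
    rw [htop, finrank_top] at h1
    have h2 : Module.finrank ℝ (TangentSpace 𝓘(ℝ, E4) q) = 4 :=
      finrank_euclideanSpace_fin (𝕜 := ℝ) (n := 4)
    rw [h2] at h1
    simp at h1
  obtain ⟨z, hz⟩ : ∃ z, z ∉ Submodule.span ℝ {v} := by
    by_contra! hall
    exact hlt (Submodule.eq_top_iff'.2 hall)
  set T := S.timeField q
  -- The time orientation T lies on the line here, so it is tilted off it to T + εz; for small ε > 0
  -- this is still future timelike.
  have h1 : ∀ᶠ ε : ℝ in 𝓝 0,
      S.val q T T + 2 * ε * S.val q T z + ε ^ 2 * S.val q z z < 0 := by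
    have hc : Continuous fun ε : ℝ ↦ S.val q T T + 2 * ε * S.val q T z + ε ^ 2 * S.val q z z := by
      fun_prop
    exact hc.continuousAt.eventually_lt_const (by simpa using hT)
  have h2 : ∀ᶠ ε : ℝ in 𝓝 0, S.val q T T + ε * S.val q T z < 0 := by
    have hc : Continuous fun ε : ℝ ↦ S.val q T T + ε * S.val q T z := by fun_prop
    exact hc.continuousAt.eventually_lt_const (by simpa using hT)
  obtain ⟨ε, ⟨hε1, hε2⟩, hε⟩ := (((h1.and h2).filter_mono nhdsWithin_le_nhds).and
    (self_mem_nhdsWithin (s := Ioi (0 : ℝ)))).exists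
  refine ⟨T + ε • z, ⟨?_, ?_⟩, fun hmem ↦ hz ?_⟩
  · have h3 : S.val q (T + ε • z) (T + ε • z) =
        S.val q T T + 2 * ε * S.val q T z + ε ^ 2 * S.val q z z := by
      simp only [map_add, map_smul, FunLike.coe_add, Pi.add_apply, FunLike.coe_smul, Pi.smul_apply,
        smul_eq_mul, S.symm q z T]
      ring
    rw [h3]
    exact hε1
  · have h3 : S.val q (T + ε • z) T = S.val q T T + ε * S.val q T z := by
      simp only [map_add, map_smul, FunLike.coe_add, Pi.add_apply, FunLike.coe_smul, Pi.smul_apply,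
        smul_eq_mul, S.symm q z T]
    rw [h3]
    exact hε2
  · have h4 := (Submodule.span ℝ {v}).sub_mem hmem h
    rw [add_sub_cancel_left] at h4
    exact (Submodule.smul_mem_iff _ (ne_of_gt hε)).1 h4

/-- Two vectors that are not parallel are separated by a pair of linear forms. -/
theorem exists_linearForms_separating {E : Type*} [AddCommGroup E] [Module ℝ E] {v w : E}
    (hv : v ≠ 0) (hw : w ∉ Submodule.span ℝ {v}) :
    ∃ φ ψ : E →ₗ[ℝ] ℝ, φ v = 1 ∧ ψ v = 1 ∧ φ w * ψ w < 0 := by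
  obtain ⟨l, hlw, hl⟩ := Submodule.exists_le_ker_of_notMem hw
  have hlv : l v = 0 := hl (Submodule.mem_span_singleton_self v)
  obtain ⟨k, hk⟩ : ∃ k : E →ₗ[ℝ] ℝ, k v = 1 := by
    obtain ⟨k, hk, -⟩ := Submodule.exists_le_ker_of_notMem (p := (⊥ : Submodule ℝ E))
      (v := v) (by simpa using hv)
    exact ⟨(k v)⁻¹ • k, by simp [hk]⟩
  -- The form l kills v. Its coefficient makes the added term at w equal to |k w| + 1, which
  -- outweighs k w, so the two forms have opposite signs at w.
  refine ⟨k + ((|k w| + 1) / l w) • l, k - ((|k w| + 1) / l w) • l, by simp [hk, hlv],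
    by simp [hk, hlv], ?_⟩
  simp only [LinearMap.add_apply, LinearMap.sub_apply, LinearMap.smul_apply, smul_eq_mul,
    div_mul_cancel₀ _ hlw]
  have h1 := neg_abs_le (k w)
  have h2 := le_abs_self (k w)
  exact mul_neg_of_pos_of_neg (by linarith) (by linarith)

/-- The inverse is the adjugate divided by the determinant, both polynomial in the entries; only the
limit has to be invertible. -/
theorem tendsto_matrix_inv {α : Type*} {l : Filter α} {m : Type*} [Fintype m] [DecidableEq m]
    {A : α → Matrix m m ℝ} {B : Matrix m m ℝ} (h : Tendsto A l (𝓝 B)) (hB : B.det ≠ 0) :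
    Tendsto (fun x ↦ (A x)⁻¹) l (𝓝 B⁻¹) := by
  simp only [Matrix.inv_def, Ring.inverse_eq_inv']
  have hdet : Tendsto (fun x ↦ (A x).det) l (𝓝 B.det) :=
    (continuous_id.matrix_det.tendsto B).comp h
  have hadj : Tendsto (fun x ↦ (A x).adjugate) l (𝓝 B.adjugate) :=
    (continuous_id.matrix_adjugate.tendsto B).comp h
  exact (hdet.inv₀ hB).smul hadj

/-! ### The rescaled fluid in the conformal extension -/

section Conformal

variable {M : Type*} [TopologicalSpace M] [ChartedSpace E4 M] [IsManifold 𝓘(ℝ, E4) 1 M]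
  {M' : Type*} [TopologicalSpace M'] [ChartedSpace E4 M'] [IsManifold 𝓘(ℝ, E4) 1 M']
  {g : Spacetime ∞ M} {g' : Spacetime 0 M'} {ι : M → M'} {Ω : M' → ℝ}

/-- The differential pulls g̃ back to Ω²g, which is nondegenerate since Ω > 0; this gives
injectivity, and the dimensions agree. -/
theorem IsC0ConformalExtension.isInvertible_mfderiv (h : IsC0ConformalExtension g g' ι Ω) (x : M) :
    (mfderiv 𝓘(ℝ, E4) 𝓘(ℝ, E4) ι x).IsInvertible := by
  have hinj : Function.Injective (mfderiv 𝓘(ℝ, E4) 𝓘(ℝ, E4) ι x) := by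
    refine (injective_iff_map_eq_zero _).2 fun v hv ↦ ?_
    refine g.eq_zero_of_forall_apply_eq_zero fun w ↦ ?_
    have h1 := h.conformal x v w
    rw [hv, map_zero] at h1
    have h2 := (pow_pos (h.pos x) 2).ne'
    simpa [h2] using h1.symm
  let D : E4 →L[ℝ] E4 := mfderiv 𝓘(ℝ, E4) 𝓘(ℝ, E4) ι x
  let e : E4 ≃L[ℝ] E4 := (LinearEquiv.ofInjectiveEndo (D : E4 →ₗ[ℝ] E4) hinj).toContinuousLinearEquiv
  exact ⟨e, ContinuousLinearMap.ext fun v ↦ rfl⟩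

/-- The push-forward of the rescaled fluid velocity `Ω⁻¹ u`, which is a unit vector of the
conformally extended metric. -/
noncomputable def conformalVelocity (ι : M → M') (Ω : M' → ℝ)
    (u : ∀ x : M, TangentSpace 𝓘(ℝ, E4) x) (x : M) : TangentSpace 𝓘(ℝ, E4) (ι x) :=
  mfderiv 𝓘(ℝ, E4) 𝓘(ℝ, E4) ι x ((Ω (ι x))⁻¹ • u x)

/-- Of the factor Ω² in g̃ = Ω²g, one power cancels against Ω⁻¹u. Thus two factors Y♭ absorb exactly
the Ω² in front of the Ricci tensor. -/
theorem IsC0ConformalExtension.apply_conformalVelocity (h : IsC0ConformalExtension g g' ι Ω)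
    (u : ∀ x : M, TangentSpace 𝓘(ℝ, E4) x) (x : M) (v : TangentSpace 𝓘(ℝ, E4) x) :
    g'.val (ι x) (conformalVelocity ι Ω u x) (mfderiv 𝓘(ℝ, E4) 𝓘(ℝ, E4) ι x v) =
      Ω (ι x) * g.val x (u x) v := by
  have h0 := (h.pos x).ne'
  rw [conformalVelocity, h.conformal]
  simp only [map_smul, FunLike.coe_smul, Pi.smul_apply, smul_eq_mul]
  field_simp

theorem IsC0ConformalExtension.apply_conformalVelocity_self (h : IsC0ConformalExtension g g' ι Ω)
    {u : ∀ x : M, TangentSpace 𝓘(ℝ, E4) x} (hu : ∀ x, g.val x (u x) (u x) = -1) (x : M) :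
    g'.val (ι x) (conformalVelocity ι Ω u x) (conformalVelocity ι Ω u x) = -1 := by
  have h0 := (h.pos x).ne'
  conv_lhs => arg 2; rw [conformalVelocity]
  rw [h.apply_conformalVelocity]
  simp only [map_smul, smul_eq_mul, hu]
  field_simp

/-- The conformally rescaled Ricci tensor of a perfect fluid. -/
theorem IsC0ConformalExtension.sq_mul_ricci_eq (h : IsC0ConformalExtension g g' ι Ω)
    {u : ∀ x : M, TangentSpace 𝓘(ℝ, E4) x} {ρ p : M → ℝ}
    (hfluid : IsPerfectFluidSolution g.toLorentzMetric u ρ p) (x : M)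
    (v w : TangentSpace 𝓘(ℝ, E4) (ι x)) :
    Ω (ι x) ^ 2 * ricci g.toLorentzMetric x ((mfderiv 𝓘(ℝ, E4) 𝓘(ℝ, E4) ι x).inverse v)
        ((mfderiv 𝓘(ℝ, E4) 𝓘(ℝ, E4) ι x).inverse w) =
      8 * Real.pi * ((ρ x + p x) * (g'.val (ι x) (conformalVelocity ι Ω u x) v *
        g'.val (ι x) (conformalVelocity ι Ω u x) w) + (ρ x - p x) / 2 * g'.val (ι x) v w) := by
  have hinv := h.isInvertible_mfderiv x
  have hv := hinv.self_apply_inverse v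
  have hw := hinv.self_apply_inverse w
  set D := mfderiv 𝓘(ℝ, E4) 𝓘(ℝ, E4) ι x
  have h1 := h.apply_conformalVelocity u x (D.inverse v)
  have h2 := h.apply_conformalVelocity u x (D.inverse w)
  have h3 := h.conformal x (D.inverse v) (D.inverse w)
  rw [hv] at h1
  rw [hw] at h2
  rw [hv, hw] at h3
  rw [h1, h2, h3, hfluid.ricci_eq]
  ring

theorem IsC0ConformalExtension.contMDiff_smul (h : IsC0ConformalExtension g g' ι Ω)
    {u : ∀ x : M, TangentSpace 𝓘(ℝ, E4) x}
    (hu : ContMDiff 𝓘(ℝ, E4) (𝓘(ℝ, E4).tangent) ∞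
      (fun x ↦ (⟨x, u x⟩ : TangentBundle 𝓘(ℝ, E4) M))) :
    ContMDiff 𝓘(ℝ, E4) (𝓘(ℝ, E4).tangent) 1
      (fun x ↦ (⟨x, (Ω (ι x))⁻¹ • u x⟩ : TangentBundle 𝓘(ℝ, E4) M)) := by
  have h1 : ContMDiff 𝓘(ℝ, E4) 𝓘(ℝ, ℝ) 1 (fun x ↦ (Ω (ι x))⁻¹) :=
    (h.smooth.of_le (by simp)).inv₀ fun x ↦ (h.pos x).ne'
  exact h1.smul_section (hu.of_le (by simp))

theorem IsC0ConformalExtension.continuous_conformalVelocity (h : IsC0ConformalExtension g g' ι Ω)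
    {u : ∀ x : M, TangentSpace 𝓘(ℝ, E4) x}
    (hu : ContMDiff 𝓘(ℝ, E4) (𝓘(ℝ, E4).tangent) ∞
      (fun x ↦ (⟨x, u x⟩ : TangentBundle 𝓘(ℝ, E4) M))) :
    Continuous (fun x ↦ (⟨ι x, conformalVelocity ι Ω u x⟩ : TangentBundle 𝓘(ℝ, E4) M')) :=
  (h.contMDiff_embedding.continuous_tangentMap le_rfl).comp (h.contMDiff_smul hu).continuous

theorem IsC0ConformalExtension.hasMFDerivAt_comp (h : IsC0ConformalExtension g g' ι Ω)
    {u : ∀ x : M, TangentSpace 𝓘(ℝ, E4) x} {γ : ℝ → M} {J : Set ℝ} (hJ : IsOpen J)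
    (hγ : IsMIntegralCurveOn γ (fun x ↦ (Ω (ι x))⁻¹ • u x) J) {t : ℝ} (ht : t ∈ J) :
    HasMFDerivAt 𝓘(ℝ, ℝ) 𝓘(ℝ, E4) (fun t ↦ ι (γ t)) t
      ((1 : ℝ →L[ℝ] ℝ).smulRight (conformalVelocity ι Ω u (γ t))) := by
  have h1 := (hγ t ht).hasMFDerivAt (hJ.mem_nhds ht)
  have h2 := ((h.contMDiff_embedding.mdifferentiable one_ne_zero (γ t)).hasMFDerivAt).comp t h1
  have h3 : ((mfderiv 𝓘(ℝ, E4) 𝓘(ℝ, E4) ι (γ t)).comp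
      ((1 : ℝ →L[ℝ] ℝ).smulRight ((Ω (ι (γ t)))⁻¹ • u (γ t))) : ℝ →L[ℝ] E4) =
      (1 : ℝ →L[ℝ] ℝ).smulRight (conformalVelocity ι Ω u (γ t) : E4) := by
    refine ContinuousLinearMap.ext_ring ?_
    exact (congrArg (mfderiv 𝓘(ℝ, E4) 𝓘(ℝ, E4) ι (γ t))
      (one_smul ℝ ((Ω (ι (γ t)))⁻¹ • u (γ t)))).trans
      (one_smul ℝ (conformalVelocity ι Ω u (γ t) : E4)).symm
  exact h3 ▸ h2

end Conformal

/-! ### Limits at O from within M -/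

/-- The filter `comap ι (𝓝 O)` expresses approach to O through points of M, from any direction; all
limits at O are taken along it or along a flow line. -/
theorem IsContinuousExtension.tendsto {M M' : Type*} [TopologicalSpace M']
    {ι : M → M'} {O : M'} {f : M → ℝ} {F : M' → ℝ} (h : IsContinuousExtension ι O f F) :
    Tendsto f (comap ι (𝓝 O)) (𝓝 (F O)) := by
  have h1 : Tendsto F (𝓝[range ι ∪ {O}] O) (𝓝 (F O)) := h.1 O (Or.inr rfl)
  have h2 : Tendsto ι (comap ι (𝓝 O)) (𝓝[range ι ∪ {O}] O) :=
    tendsto_nhdsWithin_iff.2 ⟨tendsto_comap, Eventually.of_forall fun x ↦ Or.inl ⟨x, rfl⟩⟩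
  exact (h1.comp h2).congr h.2

theorem tendsto_gramMatrix {X M' : Type*} [TopologicalSpace M'] [ChartedSpace E4 M']
    [IsManifold 𝓘(ℝ, E4) 1 M'] (g' : Spacetime 0 M') {e : OpenPartialHomeomorph M' E4} {O : M'}
    (he : e ∈ IsManifold.maximalAtlas 𝓘(ℝ, E4) 1 M') (hO : O ∈ e.source) (ι : X → M') :
    Tendsto (fun x ↦ gramMatrix g'.toLorentzMetric e (ι x)) (comap ι (𝓝 O))
      (𝓝 (gramMatrix g'.toLorentzMetric e O)) :=
  ((continuousOn_gramMatrix g'.toLorentzMetric he).continuousAt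
    (e.open_source.mem_nhds hO)).tendsto.comp tendsto_comap

/-- If the symmetric square of a covector field converges at `O`, so does that of its metric
dual. -/
theorem exists_tendsto_vecCoord_mul {X M' : Type*} [TopologicalSpace M'] [ChartedSpace E4 M']
    [IsManifold 𝓘(ℝ, E4) 1 M'] (g' : Spacetime 0 M') {e : OpenPartialHomeomorph M' E4} {O : M'}
    {ι : X → M'}
    (he : e ∈ IsManifold.maximalAtlas 𝓘(ℝ, E4) 1 M') (hO : O ∈ e.source)
    (Y : ∀ x : X, TangentSpace 𝓘(ℝ, E4) (ι x)) (T : Fin 4 → Fin 4 → ℝ)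
    (hT : ∀ μ ν, Tendsto (fun x ↦ g'.val (ι x) (Y x) (coordVec e (ι x) μ) *
      g'.val (ι x) (Y x) (coordVec e (ι x) ν)) (comap ι (𝓝 O)) (𝓝 (T μ ν))) (μ ν : Fin 4) :
    ∃ W, Tendsto (fun x ↦ vecCoord e (Y x) μ * vecCoord e (Y x) ν) (comap ι (𝓝 O)) (𝓝 W) := by
  have hG := tendsto_matrix_inv (tendsto_gramMatrix g' he hO ι)
    (det_gramMatrix_ne_zero g'.toLorentzMetric he hO)
  have hG' : ∀ i j, Tendsto (fun x ↦ (gramMatrix g'.toLorentzMetric e (ι x))⁻¹ i j)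
      (comap ι (𝓝 O)) (𝓝 ((gramMatrix g'.toLorentzMetric e O)⁻¹ i j)) := fun i j ↦
    tendsto_pi_nhds.1 (tendsto_pi_nhds.1 hG i) j
  refine ⟨_, Tendsto.congr' ?_ (tendsto_finsetSum Finset.univ fun i _ ↦
    tendsto_finsetSum Finset.univ fun j _ ↦ ((hG' μ i).mul (hG' ν j)).mul (hT i j))⟩
  filter_upwards [tendsto_comap.eventually (e.open_source.mem_nhds hO)] with x hx
  rw [vecCoord_eq_inv_mulVec g'.toLorentzMetric he hx]
  simp only [Matrix.mulVec, dotProduct, Finset.sum_mul_sum]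
  exact Finset.sum_congr rfl fun i _ ↦ Finset.sum_congr rfl fun j _ ↦ by ring

/-! ### The double cone argument -/

section Separation

variable {M : Type*} [TopologicalSpace M] [ChartedSpace E4 M] [IsManifold 𝓘(ℝ, E4) 1 M]
  {M' : Type*} [TopologicalSpace M'] [ChartedSpace E4 M'] [IsManifold 𝓘(ℝ, E4) 1 M']
  {g : Spacetime ∞ M} {g' : Spacetime 0 M'} {ι : M → M'} {Ω : M' → ℝ}
  {e : OpenPartialHomeomorph M' E4} {O : M'}

/-- The value of a linear form on a vector given by its components. -/
theorem linearForm_toLp (φ : E4 →ₗ[ℝ] ℝ) (c : Fin 4 → ℝ) :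
    φ (WithLp.toLp 2 c) = ∑ μ, c μ * φ (EuclideanSpace.single μ 1) := by
  have h : (WithLp.toLp 2 c : E4) = ∑ μ, c μ • EuclideanSpace.single μ (1 : ℝ) := by
    ext i
    fin_cases i <;> simp [Fin.sum_univ_four]
  rw [h, map_sum]
  simp

/-- If the integral curves of `Ω⁻¹ u` emanate from `O`, then it is impossible that their
velocities are confined near `O` to a double cone which is avoided by some future-directed timelike
vector at `O`. -/
theorem not_eventually_linearForms_mul_pos (hext : IsC0ConformalExtension g g' ι Ω)
    (he : e ∈ IsManifold.maximalAtlas 𝓘(ℝ, E4) 1 M') (hO : O ∈ e.source)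
    (hM : range ι = g'.timelikeFuture O univ) (hcausal : g'.IsStronglyCausalAt O)
    {u : ∀ x : M, TangentSpace 𝓘(ℝ, E4) x} (hunit : ∀ x, g.val x (u x) (u x) = -1)
    (hu : ContMDiff 𝓘(ℝ, E4) (𝓘(ℝ, E4).tangent) ∞
      (fun x ↦ (⟨x, u x⟩ : TangentBundle 𝓘(ℝ, E4) M)))
    (hpast : ∀ (γ : ℝ → M) (J : Set ℝ),
      IsMaximalIntegralCurve (fun x ↦ (Ω (ι x))⁻¹ • u x) γ J →
      Tendsto (fun t : J ↦ ι (γ t)) atBot (𝓝 O))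
    {w : E4} (hw : g'.IsFutureTimelike O (mfderiv 𝓘(ℝ, E4) 𝓘(ℝ, E4) e.symm (e O) w))
    {φ ψ : E4 →ₗ[ℝ] ℝ} (hφψ : φ w * ψ w < 0) :
    ¬ ∀ᶠ x in comap ι (𝓝 O), 0 < φ (WithLp.toLp 2 (vecCoord e (conformalVelocity ι Ω u x))) *
      ψ (WithLp.toLp 2 (vecCoord e (conformalVelocity ι Ω u x))) := by
  intro hcone
  obtain ⟨U, hU, hUcone⟩ := mem_comap.1 hcone
  obtain ⟨V, hV, hVU⟩ := hcausal.exists_mapsTo (inter_mem hU (e.open_source.mem_nhds hO))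
  have hline : Tendsto (fun s : ℝ ↦ e O + s • w) (𝓝[>] 0) (𝓝 (e O)) := by
    have hc : Continuous (fun s : ℝ ↦ e O + s • w) := by fun_prop
    have h := hc.tendsto 0
    simp only [zero_smul, add_zero] at h
    exact h.mono_left nhdsWithin_le_nhds
  have hsymm : Tendsto e.symm (𝓝 (e O)) (𝓝 O) := by
    have h := (e.continuousAt_symm (e.map_source hO)).tendsto
    rwa [e.left_inv hO] at h
  -- The coordinate ray from O in the direction w provides a point lying in V, in the chart and in
  -- I⁺(O) = M.
  obtain ⟨s, ⟨⟨hsV, hst⟩, hsf⟩, hs0⟩ := ((((hsymm.comp hline).eventually hV).and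
    (hline.eventually (e.open_target.mem_nhds (e.map_source hO)))).and
    (g'.eventually_mem_timelikeFuture he hO w hw)).and self_mem_nhdsWithin |>.exists
  rw [← hM] at hsf
  obtain ⟨x, hx⟩ := hsf
  obtain ⟨γ, J, hγ, h0J, hγ0⟩ := exists_isMaximalIntegralCurve (hext.contMDiff_smul hu) x
  have hJ := hγ.1
  have hcurve := hγ.2.2.2.1
  have hder : ∀ t ∈ J, HasMFDerivAt 𝓘(ℝ, ℝ) 𝓘(ℝ, E4) (fun t ↦ ι (γ t)) t
      ((1 : ℝ →L[ℝ] ℝ).smulRight (conformalVelocity ι Ω u (γ t))) := fun t ht ↦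
    hext.hasMFDerivAt_comp hJ hcurve ht
  have hlift : ContinuousOn (fun t ↦ (⟨ι (γ t), conformalVelocity ι Ω u (γ t)⟩ :
      TangentBundle 𝓘(ℝ, E4) M')) J :=
    (hext.continuous_conformalVelocity hu).comp_continuousOn hcurve.continuousOn
  have htl : ∀ t ∈ J, g'.IsTimelike (conformalVelocity ι Ω u (γ t)) := fun t _ ↦ by
    rw [LorentzMetric.IsTimelike, hext.apply_conformalVelocity_self hunit]
    norm_num
  have hend : ι (γ 0) = e.symm (e O + s • w) := by rw [hγ0, hx]
  have key : ∀ a ∈ J, a < 0 → ι (γ a) ∈ V →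
      0 ≤ φ (e O + s • w - e (ι (γ a))) * ψ (e O + s • w - e (ι (γ a))) := by
    intro a ha ha0 haV
    have hmaps := hVU (fun t ↦ ι (γ t)) (fun t ↦ conformalVelocity ι Ω u (γ t)) J hJ hγ.2.1
      hder hlift htl a ha 0 h0J ha0 haV (by rw [hend]; exact hsV)
    have hsub : Icc a 0 ⊆ J := hγ.2.1.out ha h0J
    have hd : ∀ (χ : E4 →ₗ[ℝ] ℝ), ∀ t ∈ Icc a 0, HasDerivAt (fun t ↦ χ (e (ι (γ t))))
        (χ (WithLp.toLp 2 (vecCoord e (conformalVelocity ι Ω u (γ t))))) t := fun χ t ht ↦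
      χ.toContinuousLinearMap.hasFDerivAt.comp_hasDerivAt t
        (hasDerivAt_chart_comp (c := fun t ↦ ι (γ t))
          (w := fun t ↦ conformalVelocity ι Ω u (γ t)) he (hmaps ht).2 (hder t (hsub ht)))
    -- Cauchy's mean value theorem yields one time r for both forms: with velocity values A, B and
    -- displacement values C, D it reads DA = CB. Hence CD·AB = (DA)² ≥ 0, and AB > 0 forces CD ≥ 0.
    obtain ⟨r, hr, hslope⟩ := exists_ratio_hasDerivAt_eq_ratio_slope _ _ ha0
      (fun t ht ↦ (hd φ t ht).continuousAt.continuousWithinAt)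
      (fun t ht ↦ hd φ t (Ioo_subset_Icc_self ht)) _ _
      (fun t ht ↦ (hd ψ t ht).continuousAt.continuousWithinAt)
      (fun t ht ↦ hd ψ t (Ioo_subset_Icc_self ht))
    have hpos := hUcone (show γ r ∈ ι ⁻¹' U from (hmaps (Ioo_subset_Icc_self hr)).1)
    rw [mem_ofPred_eq] at hpos
    rw [hend, e.right_inv hst, ← map_sub, ← map_sub] at hslope
    set A := φ (WithLp.toLp 2 (vecCoord e (conformalVelocity ι Ω u (γ r))))
    set B := ψ (WithLp.toLp 2 (vecCoord e (conformalVelocity ι Ω u (γ r))))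
    set C := φ (e O + s • w - e (ι (γ a)))
    set D := ψ (e O + s • w - e (ι (γ a)))
    have hprod : 0 ≤ (C * D) * (A * B) := by
      have h1 : (C * D) * (A * B) = (D * A) ^ 2 := by
        rw [show (C * D) * (A * B) = (D * A) * (C * B) by ring, ← hslope]
        ring
      rw [h1]
      positivity
    exact nonneg_of_mul_nonneg_left hprod hpos
  have : Nonempty J := ⟨⟨0, h0J⟩⟩
  obtain ⟨j, hj, hj0⟩ : ∃ j ∈ J, j < 0 := by
    obtain ⟨ε, hε, hball⟩ := Metric.isOpen_iff.1 hJ 0 h0J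
    refine ⟨-(ε / 2), hball ?_, by linarith⟩
    rw [Metric.mem_ball, Real.dist_0_eq_abs, abs_neg, abs_of_pos (by linarith)]
    linarith
  have hlim := hpast γ J hγ
  have hev : ∀ᶠ a : J in atBot,
      0 ≤ φ (e O + s • w - e (ι (γ a))) * ψ (e O + s • w - e (ι (γ a))) := by
    filter_upwards [eventually_le_atBot (⟨j, hj⟩ : J), hlim.eventually hV] with a haj haV
    exact key a a.2 (lt_of_le_of_lt haj hj0) haV
  have hdiff : Tendsto (fun a : J ↦ e O + s • w - e (ι (γ a))) atBot
      (𝓝 (e O + s • w - e O)) :=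
    tendsto_const_nhds.sub ((e.continuousAt hO).tendsto.comp hlim)
  have hφc : Continuous φ := φ.continuous_of_finiteDimensional
  have hψc : Continuous ψ := ψ.continuous_of_finiteDimensional
  -- As a runs to the past end, the displacement tends to s • w, so s² φ(w)ψ(w) ≥ 0, against the
  -- choice of φ and ψ.
  have hge := ge_of_tendsto (((hφc.tendsto _).comp hdiff).mul ((hψc.tendsto _).comp hdiff)) hev
  rw [add_sub_cancel_left, map_smul, map_smul, smul_eq_mul, smul_eq_mul] at hge
  have hs2 : 0 < s ^ 2 := pow_pos hs0 2
  nlinarith [mul_neg_of_pos_of_neg hs2 hφψ]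

end Separation

/-! ### The limit of the rescaled Ricci tensor -/

theorem corollary5p3
    {M : Type*} [TopologicalSpace M] [ChartedSpace E4 M] [IsManifold 𝓘(ℝ, E4) ∞ M]
    [T2Space M] [SecondCountableTopology M] [ConnectedSpace M]
    {M' : Type*} [TopologicalSpace M'] [ChartedSpace E4 M'] [IsManifold 𝓘(ℝ, E4) 1 M']
    [T2Space M'] [SecondCountableTopology M'] [ConnectedSpace M']
    (g : Spacetime ∞ M) (g' : Spacetime 0 M') (ι : M → M') (Ω : M' → ℝ)
    (hext : IsC0ConformalExtension g g' ι Ω)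
    (O : M') (hO : O ∈ pastConformalBoundary g' ι Ω)
    (hM : range ι = g'.timelikeFuture O univ)
    (u : ∀ x : M, TangentSpace 𝓘(ℝ, E4) x) (ρ p : M → ℝ)
    -- Einstein equations with a perfect fluid
    (hfluid : IsPerfectFluidSolution g.toLorentzMetric u ρ p)
    -- the flow lines of the fluid emanate from `O`, with timelike limiting velocity
    (hpast : ∀ (γ : ℝ → M) (J : Set ℝ), IsMaximalIntegralCurve u γ J →
      Tendsto (fun t : J ↦ ι (γ t)) atBot (𝓝 O))
    (hvel : ∀ (γ : ℝ → M) (J : Set ℝ),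
      IsMaximalIntegralCurve (fun x ↦ (Ω (ι x))⁻¹ • u x) γ J →
      ∃ v : TangentSpace 𝓘(ℝ, E4) O, g'.IsTimelike v ∧
        Tendsto (fun t : J ↦ (⟨ι (γ t), mfderiv 𝓘(ℝ, E4) 𝓘(ℝ, E4) ι (γ t)
          ((Ω (ι (γ t)))⁻¹ • u (γ t))⟩ : TangentBundle 𝓘(ℝ, E4) M')) atBot
          (𝓝 (⟨O, v⟩ : TangentBundle 𝓘(ℝ, E4) M')))
    -- continuous extensions of `ρ`, `p` and `Ω² Ric_g` to `M ∪ {O}`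
    (ρ' : M' → ℝ) (hρ : IsContinuousExtension ι O ρ ρ')
    (p' : M' → ℝ) (hp : IsContinuousExtension ι O p p')
    (L : TangentSpace 𝓘(ℝ, E4) O →L[ℝ] TangentSpace 𝓘(ℝ, E4) O →L[ℝ] ℝ)
    (hL : BilinExtendsContinuously ι O (fun x v w ↦ Ω (ι x) ^ 2 * ricci g.toLorentzMetric x v w) L)
    -- strong causality at `O`
    (hcausal : g'.IsStronglyCausalAt O) :
    L = (8 * Real.pi * ρ' O) • g'.val O := by
  obtain ⟨e, he, hOe, hF⟩ := hL
  set Y := conformalVelocity ι Ω u with hY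
  set 𝓕 := comap ι (𝓝 O)
  have hsrc : ∀ᶠ x in 𝓕, ι x ∈ e.source := tendsto_comap.eventually (e.open_source.mem_nhds hOe)
  have hρl := hρ.tendsto
  have hpl := hp.tendsto
  have hGl : ∀ μ ν, Tendsto (fun x ↦ gramMatrix g'.toLorentzMetric e (ι x) μ ν) 𝓕
      (𝓝 (gramMatrix g'.toLorentzMetric e O μ ν)) := fun μ ν ↦
    tendsto_pi_nhds.1 (tendsto_pi_nhds.1 (tendsto_gramMatrix g' he hOe ι) μ) ν
  have hric : ∀ μ ν, Tendsto (fun x ↦ 8 * Real.pi * ((ρ x + p x) *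
      (g'.val (ι x) (Y x) (coordVec e (ι x) μ) * g'.val (ι x) (Y x) (coordVec e (ι x) ν)) +
      (ρ x - p x) / 2 * gramMatrix g'.toLorentzMetric e (ι x) μ ν)) 𝓕
      (𝓝 (L (coordVec e O μ) (coordVec e O ν))) := by
    intro μ ν
    obtain ⟨F, hFc, hFι, hFO⟩ := hF μ ν
    have h1 : Tendsto F (𝓝[e.source ∩ range ι ∪ {O}] O) (𝓝 (F O)) := hFc O (Or.inr rfl)
    have h2 : Tendsto ι 𝓕 (𝓝[e.source ∩ range ι ∪ {O}] O) :=
      tendsto_nhdsWithin_iff.2 ⟨tendsto_comap, hsrc.mono fun x hx ↦ Or.inl ⟨hx, x, rfl⟩⟩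
    rw [← hFO]
    refine (h1.comp h2).congr' ?_
    filter_upwards [hsrc] with x hx
    exact (hFι x hx).trans (hext.sq_mul_ricci_eq hfluid x _ _)
  -- Convergence in the tangent bundle includes convergence of base points, so the integral curves
  -- of Ω⁻¹u also emanate from O.
  have hvel' : ∀ (γ : ℝ → M) (J : Set ℝ),
      IsMaximalIntegralCurve (fun x ↦ (Ω (ι x))⁻¹ • u x) γ J →
      Tendsto (fun t : J ↦ ι (γ t)) atBot (𝓝 O) := by
    intro γ J hγ
    obtain ⟨v, -, hv⟩ := hvel γ J hγ
    exact ((FiberBundle.continuous_proj E4 (TangentSpace 𝓘(ℝ, E4) (M := M'))).tendsto _).comp hv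
  obtain ⟨x₀⟩ : Nonempty M := inferInstance
  -- One fixed flow line serves to identify all the limits below.
  obtain ⟨γ, J, hγ, h0J, -⟩ := exists_isMaximalIntegralCurve
    (hext.contMDiff_smul hfluid.smooth) x₀
  have : Nonempty J := ⟨⟨0, h0J⟩⟩
  have hγl : Tendsto (fun t : J ↦ γ t) atBot 𝓕 := tendsto_comap_iff.2 (hvel' γ J hγ)
  obtain ⟨v, hvtl, hv⟩ := hvel γ J hγ
  have hVl : ∀ μ, Tendsto (fun t : J ↦ vecCoord e (Y (γ t)) μ) atBot (𝓝 (vecCoord e v μ)) :=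
    fun μ ↦ ((continuousOn_vecCoord he μ).continuousAt
      ((e.open_source.preimage (FiberBundle.continuous_proj E4
        (TangentSpace 𝓘(ℝ, E4) (M := M')))).mem_nhds hOe)).tendsto.comp hv
  have hUl : ∀ μ, Tendsto (fun t : J ↦ g'.val (ι (γ t)) (Y (γ t)) (coordVec e (ι (γ t)) μ)) atBot
      (𝓝 (g'.val O v (coordVec e O μ))) := by
    intro μ
    rw [apply_coordVec g'.toLorentzMetric he hOe]
    refine Tendsto.congr' ?_ (tendsto_finsetSum Finset.univ fun i _ ↦
      ((hGl μ i).comp hγl).mul (hVl i))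
    filter_upwards [hγl.eventually hsrc] with t ht
    exact (apply_coordVec g'.toLorentzMetric he ht _ μ).symm
  have hzero : ρ' O + p' O = 0 := by
    by_contra hne
    -- Solve the formula for Ω² Ric for Y♭⊗Y♭, dividing by ρ+p, which is nonzero near O.
    have hT : ∀ μ ν, Tendsto (fun x ↦ g'.val (ι x) (Y x) (coordVec e (ι x) μ) *
        g'.val (ι x) (Y x) (coordVec e (ι x) ν)) 𝓕
        (𝓝 ((L (coordVec e O μ) (coordVec e O ν) / (8 * Real.pi) -
          (ρ' O - p' O) / 2 * gramMatrix g'.toLorentzMetric e O μ ν) / (ρ' O + p' O))) := by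
      intro μ ν
      refine Tendsto.congr' ?_ ((((hric μ ν).div_const (8 * Real.pi)).sub
        (((hρl.sub hpl).div_const 2).mul (hGl μ ν))).div (hρl.add hpl) hne)
      filter_upwards [(hρl.add hpl).eventually_ne hne] with x hx
      have hπ := Real.pi_ne_zero
      rw [Pi.div_apply]
      field_simp
      ring
    choose W hW using exists_tendsto_vecCoord_mul g' he hOe Y _ hT
    -- The limit from all of M exists, so it can be read off along the chosen flow line.
    have hWv : ∀ μ ν, W μ ν = vecCoord e v μ * vecCoord e v ν := fun μ ν ↦
      tendsto_nhds_unique ((hW μ ν).comp hγl) ((hVl μ).mul (hVl ν))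
    obtain ⟨w, hw, hwv⟩ := g'.exists_isFutureTimelike_notMem_span O v
    have hv0 : v ≠ 0 := by
      rintro rfl
      rw [LorentzMetric.IsTimelike, map_zero] at hvtl
      exact lt_irrefl _ hvtl
    obtain ⟨φ, ψ, hφv, hψv, hφψ⟩ := exists_linearForms_separating hv0 hwv
    set D : E4 →ₗ[ℝ] TangentSpace 𝓘(ℝ, E4) O :=
      (show E4 →L[ℝ] TangentSpace 𝓘(ℝ, E4) O from
        mfderiv 𝓘(ℝ, E4) 𝓘(ℝ, E4) e.symm (e O)).toLinearMap
    have hD : ∀ z : TangentSpace 𝓘(ℝ, E4) O, D (WithLp.toLp 2 (vecCoord e z)) = z := fun z ↦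
      DFunLike.congr_fun ((mdifferentiable_of_mem_maximalAtlas_one he).symm_comp_deriv hOe) z
    have hw' : g'.IsFutureTimelike O (D (WithLp.toLp 2 (vecCoord e w))) := by rwa [hD]
    refine not_eventually_linearForms_mul_pos hext he hOe hM hcausal hfluid.unit hfluid.smooth hvel'
      hw' (φ := φ ∘ₗ D) (ψ := ψ ∘ₗ D) ?_ ?_
    · simpa only [LinearMap.comp_apply, hD] using hφψ
    -- The product is a linear combination of the components of Y⊗Y, so it converges although Y
    -- itself might change sign. Its limit is φ(v)ψ(v) = 1.
    · have hlim : Tendsto (fun x ↦ (φ ∘ₗ D) (WithLp.toLp 2 (vecCoord e (Y x))) *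
          (ψ ∘ₗ D) (WithLp.toLp 2 (vecCoord e (Y x)))) 𝓕 (𝓝 ((φ ∘ₗ D)
          (WithLp.toLp 2 (vecCoord e v)) * (ψ ∘ₗ D) (WithLp.toLp 2 (vecCoord e v)))) := by
        simp only [linearForm_toLp, Finset.sum_mul_sum]
        refine tendsto_finsetSum _ fun i _ ↦ tendsto_finsetSum _ fun j _ ↦ ?_
        have h := (hW i j).mul_const ((φ ∘ₗ D) (EuclideanSpace.single i 1) *
          (ψ ∘ₗ D) (EuclideanSpace.single j 1))
        rw [hWv] at h
        convert h using 2 <;> ring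
      refine hlim.eventually_const_lt ?_
      simp only [LinearMap.comp_apply, hD, hφv, hψv]
      norm_num
  have hval : ∀ μ ν, L (coordVec e O μ) (coordVec e O ν) =
      8 * Real.pi * ρ' O * g'.val O (coordVec e O μ) (coordVec e O ν) := by
    intro μ ν
    -- The limit is taken along the flow line because Y♭ converges there; elsewhere Y♭ is not known
    -- to stay bounded, so ρ+p → 0 alone would not remove the first term.
    have h1 := tendsto_nhds_unique ((hric μ ν).comp hγl) ((((hρl.add hpl).comp hγl).mul
      ((hUl μ).mul (hUl ν))).add ((((hρl.sub hpl).div_const 2).comp hγl).mul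
      ((hGl μ ν).comp hγl)) |>.const_mul (8 * Real.pi))
    rw [h1, hzero, show p' O = -ρ' O by linarith]
    simp only [gramMatrix, Matrix.of_apply]
    ring
  ext a b
  rw [← sum_vecCoord_smul_coordVec he hOe a, ← sum_vecCoord_smul_coordVec he hOe b]
  simp only [map_sum, map_smul, FunLike.coe_sum, Finset.sum_apply, FunLike.coe_smul, Pi.smul_apply,
    smul_eq_mul, hval]
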